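/- Let $N\ge 2$ and let $\chi$ be a primitive Dirichlet character of modulus $N$, with complex conjugate $\overline{\chi}=\chi^{-1}$ and Gauss sum $G(\chi)=\sum_{j=1}^{N-1}\chi(j)e^{2\pi i j/N}$. For $\operatorname{Im} y>0$ and $q=e^{2\pi i y}$ put $$\mathfrak g(y)=\sum_{k=1}^{N}\chi(k)\,\log(q^k;q^N)_\infty ,\qquad \log(q^k;q^N)_\infty:=\sum_{n\ge 0}\log\bigl(1-q^{k+nN}\bigr)$$ (principal logarithms). **Definitions.** For complex numbers $a_n$ ($n\ge0$), the series $\sum_{n\ge 0}a_ny^{n+1}$ is *Gevrey-1* if $|a_n|\le C\mathcal A^{-n}n!$ for some $C$ and some $\mathcal A>0$ and all $n$; its *Borel transform* is $\mathcal B(\zeta)=\sum_{n\ge0}\frac{a_n}{n!}\zeta^n$. For $\omega\in\mathbb C\setminus\{0\}$ and $(S_m)_{m\in\mathbb Z\setminus\{0\}}$ in $\mathbb C$, the series *has Stokes constants $S_m$ at the points $m\omega$* if $\mathcal B$ converges near $0$, extends analytically to $\mathbb C\setminus\{m\omega: m\in\mathbb Z,\ m\neq0\}$, and for every $m\ne 0$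 $$\mathcal B(\zeta)=-\frac{S_m}{2\pi i(\zeta-m\omega)}+(\text{regular at } m\omega).$$ The series is *modular resurgent* if it is Gevrey-1, has Stokes constants $S_m$ at points $m\omega$ for some $\omega\ne0$ and some $S_m$ with $S_m\neq0$ for all $m\neq 0$, and each of $L_+(s)=\sum_{m>0}S_mm^{-s}$ and $L_-(s)=-\sum_{m>0}S_{-m}m^{-s}$ is an *$L$-function*. Here $\sum_{m>0}A_mm^{-s}$ is an $L$-function if $A_1\ne0$, the series converges in some half-plane $\{\operatorname{Re}s>c\}$, $c\ge0$, where it equals $A_1\prod_{p\text{ prime}}\sum_{k\ge0}\frac{A_{p^k}}{A_1}p^{-ks}$, and it continues meromorphically to $\mathbb C$. **Theorem.** 1. There are unique complex numbers $\alpha,\beta,\gamma$ and $a_n$ ($n\ge0$) such that $$\mathfrak g(y)\sim\tilde{\mathfrak g}(y)=\frac{\alpha}{y}+\beta\log(-2\pi i y)+\gamma+\sum_{n\ge0}a_ny^{n+1}\qquad(y\to0,\ \operatorname{Im}y>0),$$ with a remainder $O(y^{M+1})$ after the term $a_{M-1}y^{M}$, for every $M\ge 0$, in each sector $\{\operatorname{Im}y>0,\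 |\operatorname{Re}y|\le c\operatorname{Im}y\}$. 2. $\tilde{\mathfrak g}$ is modular resurgent (that is, its power series part $\sum_{n\ge 0}a_ny^{n+1}$ is) if and only if $\chi$ is odd, i.e. $\chi(-1)=-1$. 3. For every $\chi$ as above, the power series part of $\tilde{\mathfrak g}(y)$ has at the points $2\pi i m/N$, $m\in\mathbb Z\setminus\{0\}$, and that of the rescaled expansion $\tilde{\mathfrak g}(y/N)$ has at the points $2\pi i m$, the Stokes constants $$S_m=-(1-\chi(-1))\,G(\chi)\sum_{d\mid m}\frac{\overline{\chi}(d)}{d},$$ the sum being over the positive divisors $d$ of $m$. 4. If $\chi$ is odd, the $S_m$ with $m>0$ are the coefficients of $-2G(\chi)L(s+1,\overline{\chi})\zeta(s)$: for $\operatorname{Re}s>1$, $\sum_{m>0}S_mm^{-s}$ converges absolutely to $-2G(\chi)L(s+1,\overline{\chi})\zeta(s)$. -/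

import Mathlib

open Complex Filter Topology Asymptotics

noncomputable section

/-- The logarithm `log (x; q)_∞ = ∑_{n ≥ 0} log (1 - x q ^ n)` of the infinite `q`-Pochhammer symbol
(`|x| < 1`, `|q| < 1`): the branch that is holomorphic there and vanishes at `x = 0`. Every summand
is a principal logarithm, evaluated in the disc of radius `1` around `1`. -/
def logQPochhammer (x q : ℂ) : ℂ := ∑' n : ℕ, Complex.log (1 - x * q ^ n)

/-- `q = e ^ (2 π i y)`. -/
def nome (y : ℂ) : ℂ := Complex.exp (2 * Real.pi * I * y)

/-- The weighted sum `𝔤(y) = ∑_{k = 1}^{N} χ(k) log (q ^ k; q ^ N)_∞` with `q = e ^ (2 π i y)`,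
for `y` in the upper half-plane. -/
def weightedG {N : ℕ} (χ : DirichletCharacter ℂ N) (y : ℂ) : ℂ :=
  ∑ k ∈ Finset.Icc 1 N, χ (k : ZMod N) * logQPochhammer (nome y ^ k) (nome y ^ N)

/-- The closed subsector `{y : Im y > 0, |Re y| ≤ c Im y}` of the upper half-plane. Every closed
subsector with vertex `0` lies in one of these. -/
def closedSubsector (c : ℝ) : Set ℂ := {y | 0 < y.im ∧ |y.re| ≤ c * y.im}

/-- The formal expression
`polar / y + logCoeff * log (-2 π i y) + const + ∑_{n ≥ 0} coeff n * y ^ (n + 1)`. -/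
@[ext] structure FormalExpansion where
  polar : ℂ
  logCoeff : ℂ
  const : ℂ
  coeff : ℕ → ℂ

/-- The expression `E` with its power series truncated to the first `M` terms. -/
def FormalExpansion.truncation (E : FormalExpansion) (M : ℕ) (y : ℂ) : ℂ :=
  E.polar / y + E.logCoeff * Complex.log (-(2 * Real.pi * I * y)) + E.const
    + ∑ n ∈ Finset.range M, E.coeff n * y ^ (n + 1)

/-- `E` is the (Poincaré) asymptotic expansion of `f` as `y → 0` with `Im y > 0`: in every closed
subsector of the upper half-plane, the remainders are `O(y ^ (M + 1))` for every order `M`. -/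
def HasAsymptoticExpansion (f : ℂ → ℂ) (E : FormalExpansion) : Prop :=
  ∀ (c : ℝ) (M : ℕ),
    (fun y => f y - E.truncation M y) =O[𝓝[closedSubsector c] 0] (fun y => y ^ (M + 1))

/-- The formal power series `∑ a n y ^ (n + 1)` is Gevrey-1. -/
def IsGevreyOne (a : ℕ → ℂ) : Prop :=
  ∃ C A : ℝ, 0 < A ∧ ∀ n : ℕ, ‖a n‖ ≤ C * (1 / A) ^ n * (n.factorial : ℝ)

/-- `F` is a single-valued analytic continuation to the open set `U ∋ 0` of the Borel transform
`∑ (a n / n!) ζ ^ n` of the formal power series `∑ a n y ^ (n + 1)`. -/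
def IsBorelContinuation (a : ℕ → ℂ) (U : Set ℂ) (F : ℂ → ℂ) : Prop :=
  (∀ᶠ ζ in 𝓝 (0 : ℂ), HasSum (fun n : ℕ => a n / (n.factorial : ℂ) * ζ ^ n) (F ζ)) ∧
    ∀ ζ ∈ U, AnalyticAt ℂ F ζ

/-- Near `ρ`, one has `F ζ = - S / (2 π i (ζ - ρ)) + (regular)`: at `ρ` the function `F` has a
simple pole with Stokes constant `S` (if `S = 0`, then `F` is regular there, up to its value at the
point). Equivalently, the resurgent series at `ρ` is the constant `S`. -/
def HasStokesConstant (F : ℂ → ℂ) (ρ S : ℂ) : Prop :=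
  ∃ h : ℂ → ℂ, AnalyticAt ℂ h ρ ∧
    ∀ᶠ ζ in 𝓝[≠] ρ, F ζ = -S / (2 * Real.pi * I * (ζ - ρ)) + h ζ

/-- The Borel transform of `∑ a n y ^ (n + 1)` continues analytically to the complement of
the points `m * A`, `m ∈ ℤ`, `m ≠ 0`; at `m * A` it is regular or has a simple pole, and its Stokes
constant there is `S m`. -/
def HasStokesTower (a : ℕ → ℂ) (A : ℂ) (S : ℤ → ℂ) : Prop :=
  ∃ F : ℂ → ℂ, IsBorelContinuation a {ζ | ∀ m : ℤ, m ≠ 0 → ζ ≠ m * A} F ∧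
    ∀ m : ℤ, m ≠ 0 → HasStokesConstant F (m * A) (S m)

/-- The numbers `A m`, `m ≥ 1`, are the coefficients of an `L`-function: the Dirichlet series
`∑ A m / m ^ s` converges in a right half-plane `Re s > C ≥ 0`, where it is `A 1 ≠ 0` times an Euler
product `∏_p ∑_{k ≥ 0} (A (p ^ k) / A 1) / p ^ (k s)`, and it continues meromorphically to `ℂ`.
(The value `A 0` plays no role.) -/
def IsLFunctionCoeff (A : ℕ → ℂ) : Prop :=
  ∃ C : ℝ, 0 ≤ C ∧ A 1 ≠ 0 ∧
    (∀ s : ℂ, C < s.re → LSeriesSummable A s ∧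
      HasProd (fun p : Nat.Primes => ∑' k : ℕ, A ((p : ℕ) ^ k) / A 1 / (((p : ℕ) ^ k : ℕ) : ℂ) ^ s)
        (LSeries A s / A 1)) ∧
    ∃ L : ℂ → ℂ, MeromorphicOn L Set.univ ∧ ∀ s : ℂ, C < s.re → L s = LSeries A s

/-- The formal power series `∑ a n y ^ (n + 1)` is a modular resurgent series: it is Gevrey-1; the
singularities of its Borel transform form one tower `m * A`, `m ∈ ℤ`, `m ≠ 0`, with `A ≠ 0`; the
resurgent series at `m * A` is a constant `S m` (nonzero, as `m * A` is a singularity); and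
`∑_{m > 0} S m / m ^ s` and `- ∑_{m > 0} S (-m) / m ^ s` are `L`-functions. -/
def IsModularResurgent (a : ℕ → ℂ) : Prop :=
  IsGevreyOne a ∧ ∃ (A : ℂ) (S : ℤ → ℂ), A ≠ 0 ∧ HasStokesTower a A S ∧
    (∀ m : ℤ, m ≠ 0 → S m ≠ 0) ∧
    IsLFunctionCoeff (fun m : ℕ => S (m : ℤ)) ∧
    IsLFunctionCoeff (fun m : ℕ => -S (-(m : ℤ)))

/-- The Gauss sum `∑_j χ(j) e ^ (2 π i j / N)`. -/
def charGaussSum {N : ℕ} [NeZero N] (χ : DirichletCharacter ℂ N) : ℂ :=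
  gaussSum χ ZMod.stdAddChar

/-- `- (1 - χ(-1)) G(χ) ∑_{d ∣ m} χ⁻¹(d) / d`, the sum being over the positive divisors of `m`. -/
def stokesG {N : ℕ} [NeZero N] (χ : DirichletCharacter ℂ N) (m : ℤ) : ℂ :=
  -(1 - χ (-1)) * charGaussSum χ *
    ∑ d ∈ m.natAbs.divisors, χ⁻¹ (d : ZMod N) / (d : ℂ)

end

/-! With t = -2πiy one has 𝔤(y) = ∑_{m ≥ 1} χ(m) log(1 - e^{-mt}). Write log(1 - e^{-z}) = log z +
ℓ(z), where ℓ = `logOneSubExpNegDiv` is analytic at 0 and on the right half-plane. As χ sums to zero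
over a period, Euler–Maclaurin summation with weights χ has no integral term, so s ↦ ℓ(st)
contributes ∑ d_j t^j ℓ^{(j)}(0). Here d_j = `weightMoment` is a combination of the values of
B_{j+1} at k/N, and ℓ^{(j)}(0) = B_j/j for j ≥ 1. The logarithms add only d_0 log t and a constant
(`exists_norm_sub_weighted_expansion_le`). So a_n is an explicit multiple of B_{n+1} ∑ χ(k)
B_{n+2}(k/N).

For even n ≥ 2 this vanishes. For odd n the Fourier series of the Bernoulli polynomials turn the two
factors into ζ(n+1) and (1 - χ(-1)) G(χ) L(n+2, χ⁻¹), whose product is, up to a constant, ∑ S_m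
m^{-(n+1)}. Hence a_n ω^{n+1}/n! = ∑_m S_m/(2πi) · (1 - (-1)^n)/m^{n+1} with ω = 2πi/N
(`hasSum_stokesG_weightedGExpansion_coeff`). Summing geometric series, the Borel transform is a_0 +
ω⁻¹ ∑_m S_m/(2πi) · (1/(m - w) - 1/(m + w)) with w = ζ/ω, and its poles can be read off
(`hasStokesTower_of_hasSum`).

For odd χ, multiplicativity of m ↦ ∑_{d ∣ m} χ⁻¹(d)/d gives S_m ≠ 0 and the Euler product, and
L(s+1, χ⁻¹) ζ(s) gives the continuation. For even χ the Borel transform is the constant a_0, which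
admits no tower of genuine poles (`not_hasStokesTower_of_eq_zero`). -/

/-! ### Weighted Euler–Maclaurin summation -/

/-- The numbers `- N ^ j / (j + 1)! * ∑ k, w k * B_{j + 1}(k / N)`: these are, up to the factor
`(-1) ^ j`, the Taylor coefficients of `∑ k, w k * exp (- k x) / (1 - exp (- N x))`. -/
noncomputable def weightMoment (N : ℕ) (w : ℕ → ℂ) (j : ℕ) : ℂ :=
  -((N : ℂ) ^ j / ((j + 1).factorial : ℂ)) *
    ∑ k ∈ Finset.Icc 1 N, w k * (bernoulliFun (j + 1) ((k : ℝ) / N) : ℂ)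

theorem sum_choose_mul_bernoulliFun (n : ℕ) (x : ℝ) :
    ∑ k ∈ Finset.range (n + 1), ((n + 1).choose k : ℝ) * bernoulliFun k x = (n + 1) * x ^ n := by
  have h := congrArg (fun p => (p.map (algebraMap ℚ ℝ)).eval x) (Polynomial.sum_bernoulli n)
  simp only [Polynomial.map_sum, Polynomial.eval_finsetSum, Polynomial.map_smul,
    Polynomial.eval_smul, Polynomial.map_monomial, Polynomial.eval_monomial] at h
  simpa [bernoulliFun] using h

/-- This is the exactness of ∑ w_k f(a+k) = ∑ d_j (f^{(j)}(a) - f^{(j)}(a+N)) on the monomial of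
degree i. In the Bernoulli identity at x = k/N the B_0 term does not depend on k, so ∑ w = 0 kills
it. -/
theorem sum_weight_pow_add_sum_weightMoment {N : ℕ} (hN : N ≠ 0) {w : ℕ → ℂ}
    (hw : ∑ k ∈ Finset.Icc 1 N, w k = 0) (i : ℕ) :
    ∑ k ∈ Finset.Icc 1 N, w k * ((k : ℂ) ^ i / (i.factorial : ℂ)) +
      ∑ j ∈ Finset.range i, weightMoment N w j * ((N : ℂ) ^ (i - j) / ((i - j).factorial : ℂ)) = 0 := by
  have hNC : (N : ℂ) ≠ 0 := Nat.cast_ne_zero.mpr hN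
  have key : ∀ k : ℕ, (k : ℂ) ^ i / (i.factorial : ℂ) = (N : ℂ) ^ i / ((i + 1).factorial : ℂ) +
      ∑ j ∈ Finset.range i, (N : ℂ) ^ j / ((j + 1).factorial : ℂ) *
        (bernoulliFun (j + 1) ((k : ℝ) / N) : ℂ) *
          ((N : ℂ) ^ (i - j) / ((i - j).factorial : ℂ)) := by
    intro k
    have h := congrArg (fun r : ℝ => (r : ℂ)) (sum_choose_mul_bernoulliFun i ((k : ℝ) / N))
    simp only [Finset.sum_range_succ', bernoulliFun_zero] at h
    push_cast at h
    have h2 : (k : ℂ) ^ i / (i.factorial : ℂ)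
        = (N : ℂ) ^ i / ((i + 1).factorial : ℂ) * ((i + 1) * ((k : ℂ) / N) ^ i) := by
      rw [Nat.factorial_succ]; push_cast
      have : (i.factorial : ℂ) ≠ 0 := Nat.cast_ne_zero.mpr i.factorial_ne_zero
      have : (i : ℂ) + 1 ≠ 0 := by exact_mod_cast i.succ_ne_zero
      rw [div_pow]
      field_simp
    rw [h2, ← h, mul_add, Finset.mul_sum, add_comm]
    congr 1
    · simp
    · refine Finset.sum_congr rfl fun j hj => ?_
      have hj := Finset.mem_range.mp hj
      rw [Nat.cast_choose ℂ (by omega : j + 1 ≤ i + 1), Nat.add_sub_add_right]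
      have h1 : (((i + 1).factorial : ℕ) : ℂ) ≠ 0 := Nat.cast_ne_zero.mpr (Nat.factorial_ne_zero _)
      have h3 : (((j + 1).factorial : ℕ) : ℂ) ≠ 0 := Nat.cast_ne_zero.mpr (Nat.factorial_ne_zero _)
      have h4 : (((i - j).factorial : ℕ) : ℂ) ≠ 0 := Nat.cast_ne_zero.mpr (Nat.factorial_ne_zero _)
      have h5 : (N : ℂ) ^ i = (N : ℂ) ^ j * (N : ℂ) ^ (i - j) := by
        rw [← pow_add]; congr 1; omega
      rw [h5]; field_simp
  simp_rw [key, mul_add, Finset.sum_add_distrib, ← Finset.sum_mul, hw, zero_mul, zero_add,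
    weightMoment, Finset.mul_sum, Finset.sum_mul]
  rw [Finset.sum_comm, ← Finset.sum_add_distrib]
  refine Finset.sum_eq_zero fun j _ => ?_
  rw [← Finset.sum_add_distrib]
  exact Finset.sum_eq_zero fun k _ => by ring

/-- Taylor's inequality for `φ 0`, where `φ (i + 1)` is the derivative of `φ i`. -/
theorem norm_sub_taylor_le {M : ℕ} {φ : ℕ → ℝ → ℂ} {a b B : ℝ} (hab : a ≤ b)
    (hφ : ∀ i < M, ∀ s ∈ Set.Icc a b, HasDerivAt (φ i) (φ (i + 1) s) s)
    (hB : ∀ s ∈ Set.Icc a b, ‖φ M s‖ ≤ B) :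
    ‖φ 0 b - ∑ i ∈ Finset.range M, φ i a * ((((b - a : ℝ) : ℂ)) ^ i / (i.factorial : ℂ))‖
      ≤ B * (b - a) ^ M := by
  induction M generalizing φ b with
  | zero => simpa using hB b ⟨hab, le_rfl⟩
  | succ M ih =>
    have hB0 : 0 ≤ B := (norm_nonneg _).trans (hB a ⟨le_rfl, hab⟩)
    set r : ℝ → ℂ := fun s => φ 0 s -
      ∑ i ∈ Finset.range (M + 1), φ i a * ((((s - a : ℝ) : ℂ)) ^ i / (i.factorial : ℂ)) with hr
    have hder : ∀ s ∈ Set.Icc a b, HasDerivWithinAt r (φ 1 s -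
        ∑ i ∈ Finset.range M, φ (i + 1) a * ((((s - a : ℝ) : ℂ)) ^ i / (i.factorial : ℂ)))
        (Set.Icc a b) s := by
      intro s hs
      have h0 : HasDerivAt (fun s : ℝ => ((s - a : ℝ) : ℂ)) 1 s := by
        simpa using ((hasDerivAt_id s).sub_const a).ofReal_comp
      have h1 : HasDerivAt (fun s : ℝ => ∑ i ∈ Finset.range (M + 1),
          φ i a * ((((s - a : ℝ) : ℂ)) ^ i / (i.factorial : ℂ)))
          (∑ i ∈ Finset.range (M + 1),
            φ i a * (i * (((s - a : ℝ) : ℂ)) ^ (i - 1) * 1 / (i.factorial : ℂ))) s :=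
        HasDerivAt.fun_sum fun i _ => ((h0.pow i).div_const _).const_mul _
      refine (((hφ 0 (Nat.succ_pos M) s hs).sub h1).congr_deriv ?_).hasDerivWithinAt
      rw [Finset.sum_range_succ']
      simp only [zero_add, Nat.cast_zero, zero_mul, zero_div, mul_zero, add_zero]
      congr 1
      refine Finset.sum_congr rfl fun i _ => ?_
      rw [Nat.factorial_succ]; push_cast
      have : (i : ℂ) + 1 ≠ 0 := by exact_mod_cast i.succ_ne_zero
      have : (i.factorial : ℂ) ≠ 0 := Nat.cast_ne_zero.mpr i.factorial_ne_zero
      field_simp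
    have hbd : ∀ s ∈ Set.Ico a b, ‖φ 1 s -
        ∑ i ∈ Finset.range M, φ (i + 1) a * ((((s - a : ℝ) : ℂ)) ^ i / (i.factorial : ℂ))‖
          ≤ B * (b - a) ^ M := by
      intro s hs
      refine (ih (φ := fun i => φ (i + 1)) hs.1
        (fun i hi u hu => hφ (i + 1) (by omega) u ⟨hu.1, hu.2.trans hs.2.le⟩)
        (fun u hu => hB u ⟨hu.1, hu.2.trans hs.2.le⟩)).trans ?_
      have := hs.1
      have := hs.2
      gcongr
    have h := norm_image_sub_le_of_norm_deriv_le_segment' hder hbd b ⟨hab, le_rfl⟩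
    have hra : r a = 0 := by simp [hr, Finset.sum_range_succ']
    rw [hra, sub_zero] at h
    rw [pow_succ, ← mul_assoc]
    exact h

/-- The constant in the weighted Euler–Maclaurin estimate of order `M`. -/
noncomputable def eulerMaclaurinConst (N : ℕ) (w : ℕ → ℂ) (M : ℕ) : ℝ :=
  ∑ k ∈ Finset.Icc 1 N, ‖w k‖ * (k : ℝ) ^ M +
    ∑ j ∈ Finset.range M, ‖weightMoment N w j‖ * (N : ℝ) ^ (M - j)

theorem eulerMaclaurinConst_nonneg (N : ℕ) (w : ℕ → ℂ) (M : ℕ) :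
    0 ≤ eulerMaclaurinConst N w M := by
  unfold eulerMaclaurinConst; positivity

/-- One period of the weighted Euler–Maclaurin formula. -/
theorem norm_sum_weight_sub_le {N : ℕ} (hN : N ≠ 0) {w : ℕ → ℂ}
    (hw : ∑ k ∈ Finset.Icc 1 N, w k = 0) {M : ℕ} {φ : ℕ → ℝ → ℂ} {a B : ℝ}
    (hφ : ∀ i < M, ∀ s ∈ Set.Icc a (a + N), HasDerivAt (φ i) (φ (i + 1) s) s)
    (hB : ∀ s ∈ Set.Icc a (a + N), ‖φ M s‖ ≤ B) :
    ‖∑ k ∈ Finset.Icc 1 N, w k * φ 0 (a + k) -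
        (∑ j ∈ Finset.range M, weightMoment N w j * φ j a -
          ∑ j ∈ Finset.range M, weightMoment N w j * φ j (a + N))‖
      ≤ eulerMaclaurinConst N w M * B := by
  set d := weightMoment N w
  -- All Taylor polynomials at `a` cancel: the coefficient of `φ i a` is the preceding moment
  -- identity. Only Taylor remainders of orders `M` and `M - j` are left to bound.
  have hmain : ∑ k ∈ Finset.Icc 1 N, w k *
        (∑ i ∈ Finset.range M, φ i a * ((k : ℂ) ^ i / (i.factorial : ℂ))) +
      ∑ j ∈ Finset.range M, d j *
        (∑ i ∈ Finset.range (M - j), φ (j + i) a * ((N : ℂ) ^ i / (i.factorial : ℂ))) -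
      ∑ j ∈ Finset.range M, d j * φ j a = 0 := by
    have h1 : ∑ j ∈ Finset.range M, d j *
        (∑ i ∈ Finset.range (M - j), φ (j + i) a * ((N : ℂ) ^ i / (i.factorial : ℂ)))
        = ∑ i ∈ Finset.range M, φ i a * (∑ j ∈ Finset.range i, d j *
          ((N : ℂ) ^ (i - j) / ((i - j).factorial : ℂ)) + d i) := by
      simp_rw [Finset.mul_sum]
      rw [← Finset.sum_range_diag_flip M (fun j i =>
        d j * (φ (j + i) a * ((N : ℂ) ^ i / (i.factorial : ℂ))))]
      refine Finset.sum_congr rfl fun i _ => ?_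
      rw [Finset.sum_range_succ, mul_add, Finset.mul_sum]
      congr 1
      · refine Finset.sum_congr rfl fun j hj => ?_
        rw [Nat.add_sub_cancel' (Finset.mem_range.mp hj).le]; ring
      · simp [mul_comm]
    have h2 : ∑ k ∈ Finset.Icc 1 N, w k *
        (∑ i ∈ Finset.range M, φ i a * ((k : ℂ) ^ i / (i.factorial : ℂ)))
        = ∑ i ∈ Finset.range M, φ i a *
          ∑ k ∈ Finset.Icc 1 N, w k * ((k : ℂ) ^ i / (i.factorial : ℂ)) := by
      simp_rw [Finset.mul_sum]
      rw [Finset.sum_comm]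
      exact Finset.sum_congr rfl fun i _ => Finset.sum_congr rfl fun k _ => by ring
    rw [h1, h2, ← Finset.sum_add_distrib, ← Finset.sum_sub_distrib]
    refine Finset.sum_eq_zero fun i _ => ?_
    linear_combination φ i a * sum_weight_pow_add_sum_weightMoment hN hw i
  have hsplit : ∑ k ∈ Finset.Icc 1 N, w k * φ 0 (a + k) -
        (∑ j ∈ Finset.range M, d j * φ j a - ∑ j ∈ Finset.range M, d j * φ j (a + N))
      = ∑ k ∈ Finset.Icc 1 N, w k * (φ 0 (a + k) -
          ∑ i ∈ Finset.range M, φ i a * ((k : ℂ) ^ i / (i.factorial : ℂ))) +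
        ∑ j ∈ Finset.range M, d j * (φ j (a + N) -
          ∑ i ∈ Finset.range (M - j), φ (j + i) a * ((N : ℂ) ^ i / (i.factorial : ℂ))) := by
    simp_rw [mul_sub, Finset.sum_sub_distrib]
    linear_combination hmain
  rw [hsplit, eulerMaclaurinConst, add_mul, Finset.sum_mul, Finset.sum_mul]
  refine (norm_add_le _ _).trans (add_le_add ?_ ?_)
  · refine (norm_sum_le _ _).trans (Finset.sum_le_sum fun k hk => ?_)
    have hk := (Finset.mem_Icc.mp hk).2
    have hkN : (k : ℝ) ≤ N := by exact_mod_cast hk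
    have h := norm_sub_taylor_le (M := M) (φ := φ) (a := a) (b := a + k) (B := B) (by simp)
      (fun i hi s hs => hφ i hi s ⟨hs.1, by linarith [hs.2]⟩)
      (fun s hs => hB s ⟨hs.1, by linarith [hs.2]⟩)
    simp only [add_sub_cancel_left, ofReal_natCast] at h
    rw [norm_mul, mul_assoc, mul_comm _ B]
    gcongr
  · refine (norm_sum_le _ _).trans (Finset.sum_le_sum fun j hj => ?_)
    have hj := Finset.mem_range.mp hj
    have h := norm_sub_taylor_le (M := M - j) (φ := fun i => φ (j + i)) (a := a) (b := a + N)
      (B := B) (by simp)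
      (fun i hi s hs => hφ (j + i) (by omega) s hs)
      (fun s hs => by simpa [Nat.add_sub_cancel' hj.le] using hB s hs)
    simp only [add_sub_cancel_left, ofReal_natCast, add_zero] at h
    rw [norm_mul, mul_assoc, mul_comm _ B]
    gcongr

/-- The weighted Euler–Maclaurin formula on `[0, ∞)`, with its remainder. -/
theorem exists_tendsto_weighted_eulerMaclaurin {N : ℕ} (hN : N ≠ 0) {w : ℕ → ℂ}
    (hw : ∑ k ∈ Finset.Icc 1 N, w k = 0) {M : ℕ} {φ : ℕ → ℝ → ℂ} {B : ℕ → ℝ}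
    (hφ : ∀ i < M, ∀ s, 0 ≤ s → HasDerivAt (φ i) (φ (i + 1) s) s)
    (hB : ∀ n : ℕ, ∀ s : ℝ, (n : ℝ) * N ≤ s → ‖φ M s‖ ≤ B n) (hBs : Summable B) :
    ∃ A : ℂ, Tendsto (fun n : ℕ => ∑ i ∈ Finset.range n, ∑ k ∈ Finset.Icc 1 N,
        w k * φ 0 ((i : ℝ) * N + k) + ∑ j ∈ Finset.range M, weightMoment N w j * φ j ((n : ℝ) * N))
        atTop (𝓝 A) ∧
      ‖A - ∑ j ∈ Finset.range M, weightMoment N w j * φ j 0‖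
        ≤ eulerMaclaurinConst N w M * ∑' n, B n := by
  set F : ℕ → ℂ := fun n => ∑ j ∈ Finset.range M, weightMoment N w j * φ j ((n : ℝ) * N) with hF
  set e : ℕ → ℂ := fun i => ∑ k ∈ Finset.Icc 1 N, w k * φ 0 ((i : ℝ) * N + k) -
    (F i - F (i + 1)) with he
  have hle : ∀ i, ‖e i‖ ≤ eulerMaclaurinConst N w M * B i := by
    intro i
    have hi0 : 0 ≤ (i : ℝ) * N := by positivity
    have h := norm_sum_weight_sub_le hN hw (M := M) (φ := φ) (a := (i : ℝ) * N) (B := B i)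
      (fun j hj s hs => hφ j hj s (hi0.trans hs.1)) (fun s hs => hB i s hs.1)
    have h1 : (((i + 1 : ℕ) : ℝ)) * N = (i : ℝ) * N + N := by push_cast; ring
    simpa only [he, hF, h1] using h
  have hsum : Summable e := Summable.of_norm_bounded (hBs.mul_left _) hle
  -- The boundary term `F n` stays on the left because it need not converge: in the application `φ
  -- 0` grows logarithmically.
  have htel : ∀ n, ∑ i ∈ Finset.range n, ∑ k ∈ Finset.Icc 1 N, w k * φ 0 ((i : ℝ) * N + k) + F n
      = F 0 + ∑ i ∈ Finset.range n, e i := by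
    intro n
    have := Finset.sum_range_sub F n
    simp only [he, Finset.sum_sub_distrib] at this ⊢
    linear_combination -this
  have hF0 : F 0 = ∑ j ∈ Finset.range M, weightMoment N w j * φ j 0 := by simp [hF]
  refine ⟨F 0 + ∑' i, e i, ?_, ?_⟩
  · exact (hsum.hasSum.tendsto_sum_nat.const_add _).congr fun n => (htel n).symm
  · rw [← hF0, add_sub_cancel_left, ← tsum_mul_left]
    exact tsum_of_norm_bounded (hBs.mul_left _).hasSum hle

/-! ### The logarithm of (1 - e^{-z})/z: analyticity, Taylor coefficients, decay -/

/-- The entire function `(1 - e ^ (-z)) / z`. -/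
noncomputable def oneSubExpNegDiv : ℂ → ℂ := dslope (fun z => -exp (-z)) 0

/-- `log ((1 - e ^ (-z)) / z)`, so that `log (1 - e ^ (-z)) = log z + logOneSubExpNegDiv z`. -/
noncomputable def logOneSubExpNegDiv (z : ℂ) : ℂ := log (oneSubExpNegDiv z)

theorem oneSubExpNegDiv_of_ne_zero {z : ℂ} (hz : z ≠ 0) :
    oneSubExpNegDiv z = (1 - exp (-z)) / z := by
  rw [oneSubExpNegDiv, dslope_of_ne _ hz, slope_def_field]; simp; ring

theorem oneSubExpNegDiv_zero : oneSubExpNegDiv 0 = 1 := by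
  rw [oneSubExpNegDiv, dslope_same]
  have : HasDerivAt (fun z : ℂ => -exp (-z)) (-(exp (-0) * (-1))) 0 :=
    ((hasDerivAt_neg (0 : ℂ)).cexp).neg
  simpa using this.deriv

theorem logOneSubExpNegDiv_zero : logOneSubExpNegDiv 0 = 0 := by
  simp [logOneSubExpNegDiv, oneSubExpNegDiv_zero]

theorem differentiable_oneSubExpNegDiv : Differentiable ℂ oneSubExpNegDiv := by
  have : DifferentiableOn ℂ oneSubExpNegDiv Set.univ :=
    (Complex.differentiableOn_dslope (by simp)).mpr (by fun_prop)
  exact differentiableOn_univ.mp this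

theorem one_sub_exp_neg_re_pos {z : ℂ} (hz : 0 < z.re) : 0 < (1 - exp (-z)).re := by
  have h1 : (exp (-z)).re ≤ ‖exp (-z)‖ := re_le_norm _
  have h2 : ‖exp (-z)‖ < 1 := by rw [norm_exp]; simpa using hz
  simp only [sub_re, one_re]; linarith

/-- Both z and 1 - e^{-z} lie in the right half-plane, so their arguments differ by less than π and
no branch jump occurs. -/
theorem exists_log_oneSubExpNegDiv {z : ℂ} (hz : 0 < z.re) :
    oneSubExpNegDiv z = exp (log (1 - exp (-z)) - log z) ∧
      |(log (1 - exp (-z)) - log z).im| < Real.pi := by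
  have h0 : z ≠ 0 := by rintro rfl; simp at hz
  have h1 := one_sub_exp_neg_re_pos hz
  have h2 : 1 - exp (-z) ≠ 0 := by intro h; rw [h] at h1; simp at h1
  refine ⟨by rw [oneSubExpNegDiv_of_ne_zero h0, exp_sub, exp_log h2, exp_log h0], ?_⟩
  have h3 := abs_lt.mp (abs_arg_lt_pi_div_two_iff.mpr (Or.inl h1))
  have h4 := abs_lt.mp (abs_arg_lt_pi_div_two_iff.mpr (Or.inl hz))
  simp only [sub_im, log_im]
  rw [abs_lt]; constructor <;> linarith

theorem log_one_sub_exp_neg {z : ℂ} (hz : 0 < z.re) :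
    log (1 - exp (-z)) = log z + logOneSubExpNegDiv z := by
  obtain ⟨h1, h2⟩ := exists_log_oneSubExpNegDiv hz
  rw [logOneSubExpNegDiv, h1, log_exp (abs_lt.mp h2).1 (abs_lt.mp h2).2.le]; ring

/-- The domain on which `logOneSubExpNegDiv` is used. -/
def rightDomain : Set ℂ := {z | 0 < z.re} ∪ Metric.ball 0 1

theorem isOpen_rightDomain : IsOpen rightDomain :=
  (isOpen_lt continuous_const continuous_re).union Metric.isOpen_ball

/-- On the half-plane the argument stays strictly below π in absolute value. On the unit ball the
quotient is within ‖z‖ < 1 of 1. The ball is included so that 0, where the rays start, is an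
interior point. -/
theorem oneSubExpNegDiv_mem_slitPlane {z : ℂ} (hz : z ∈ rightDomain) :
    oneSubExpNegDiv z ∈ slitPlane := by
  rcases hz with hz | hz
  · obtain ⟨h1, h2⟩ := exists_log_oneSubExpNegDiv hz
    have hne : oneSubExpNegDiv z ≠ 0 := by rw [h1]; exact exp_ne_zero _
    rw [mem_slitPlane_iff_arg]
    refine ⟨fun h => ?_, hne⟩
    rw [h1, ← log_im, log_exp (abs_lt.mp h2).1 (abs_lt.mp h2).2.le] at h
    exact absurd (abs_lt.mp h2).2 (by rw [h]; simp)
  · rw [mem_ball_zero_iff] at hz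
    by_cases h0 : z = 0
    · rw [h0, oneSubExpNegDiv_zero]; simp
    · have h := norm_exp_sub_one_sub_id_le (x := -z) (by simpa using hz.le)
      have h3 : oneSubExpNegDiv z = 1 + -((exp (-z) - 1 - (-z)) / z) := by
        rw [oneSubExpNegDiv_of_ne_zero h0]; field_simp; ring
      rw [h3]
      refine mem_slitPlane_of_norm_lt_one ?_
      rw [norm_neg, norm_div, div_lt_one (norm_pos_iff.mpr h0)]
      rw [norm_neg] at h
      nlinarith [norm_pos_iff.mpr h0]

theorem analyticAt_logOneSubExpNegDiv {z : ℂ} (hz : z ∈ rightDomain) :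
    AnalyticAt ℂ logOneSubExpNegDiv z :=
  (differentiable_oneSubExpNegDiv.analyticAt z).clog (oneSubExpNegDiv_mem_slitPlane hz)

theorem hasDerivAt_iteratedDeriv_logOneSubExpNegDiv (j : ℕ) {z : ℂ} (hz : z ∈ rightDomain) :
    HasDerivAt (iteratedDeriv j logOneSubExpNegDiv)
      (iteratedDeriv (j + 1) logOneSubExpNegDiv z) z := by
  rw [iteratedDeriv_succ]
  refine DifferentiableAt.hasDerivAt ?_
  rw [iteratedDeriv_eq_iterate]
  exact ((analyticAt_logOneSubExpNegDiv hz).iterated_deriv j).differentiableAt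

theorem exp_sub_one_ne_zero_of_mem_rightDomain {z : ℂ} (hz : z ∈ rightDomain) (h0 : z ≠ 0) :
    exp z - 1 ≠ 0 := by
  intro h
  have h1 := slitPlane_ne_zero (oneSubExpNegDiv_mem_slitPlane hz)
  rw [oneSubExpNegDiv_of_ne_zero h0, exp_neg, sub_eq_zero.mp h] at h1
  simp at h1

theorem deriv_logOneSubExpNegDiv {z : ℂ} (hz : z ∈ rightDomain) (h0 : z ≠ 0) :
    deriv logOneSubExpNegDiv z = 1 / (exp z - 1) - 1 / z := by
  have h1 : HasDerivAt oneSubExpNegDiv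
      ((exp (-z) * z - (1 - exp (-z)) * 1) / z ^ 2) z := by
    have h2 : HasDerivAt (fun z : ℂ => 1 - exp (-z)) (exp (-z)) z := by
      simpa using ((hasDerivAt_neg z).cexp).const_sub 1
    refine (h2.div (hasDerivAt_id z) h0).congr_of_eventuallyEq ?_
    filter_upwards [isOpen_ne.mem_nhds h0] with u hu
    simpa using oneSubExpNegDiv_of_ne_zero hu
  have h3 : HasDerivAt logOneSubExpNegDiv _ z := h1.clog (oneSubExpNegDiv_mem_slitPlane hz)
  rw [h3.deriv, oneSubExpNegDiv_of_ne_zero h0]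
  have h4 := exp_sub_one_ne_zero_of_mem_rightDomain hz h0
  have h5 : exp (-z) = 1 / exp z := by rw [exp_neg, one_div]
  have h6 := exp_ne_zero z
  have h7 : 1 - 1 / exp z = (exp z - 1) / exp z := by field_simp
  rw [h5, h7]
  field_simp

theorem iteratedDeriv_exp_sub_one_zero (n : ℕ) :
    iteratedDeriv n (fun z : ℂ => exp z - 1) 0 = if n = 0 then 0 else 1 := by
  cases n with
  | zero => simp
  | succ n =>
    have : deriv (fun z : ℂ => exp z - 1) = exp := by ext z; simp
    rw [iteratedDeriv_succ', this, iteratedDeriv_eq_iterate, Complex.iter_deriv_exp]; simp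

theorem iteratedDeriv_id_mul_zero (n : ℕ) {f : ℂ → ℂ} (hf : AnalyticAt ℂ f 0) :
    iteratedDeriv (n + 1) (fun z => z * f z) 0 = (n + 1) * iteratedDeriv n f 0 := by
  rw [iteratedDeriv_fun_mul (by fun_prop) hf.contDiffAt, Finset.sum_eq_single 1]
  · simp
  · intro i _ hi
    rcases i with _ | _ | i
    · simp
    · simp at hi
    · have : iteratedDeriv (i + 1 + 1) (fun z : ℂ => z) 0 = 0 := by
        rw [iteratedDeriv_succ', iteratedDeriv_succ']; simp
      simp [this]
  · simp

/-- The function is z/(e^z - 1), the generating function of the Bernoulli numbers. Leibniz' rule for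
its product with e^z - 1 yields their defining recursion. -/
theorem iteratedDeriv_one_add_id_mul_deriv_zero (n : ℕ) :
    iteratedDeriv n (fun z => 1 + z * deriv logOneSubExpNegDiv z) 0 = (bernoulli n : ℂ) := by
  have hmem : (0 : ℂ) ∈ rightDomain := Or.inr (by simp)
  have hb : AnalyticAt ℂ (deriv logOneSubExpNegDiv) 0 := (analyticAt_logOneSubExpNegDiv hmem).deriv
  set f : ℂ → ℂ := fun z => 1 + z * deriv logOneSubExpNegDiv z with hf
  have hfa : AnalyticAt ℂ f 0 := analyticAt_const.add (analyticAt_id.mul hb)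
  have hprod : (fun z => f z * (exp z - 1)) =ᶠ[𝓝 0] fun z => z * 1 := by
    filter_upwards [isOpen_rightDomain.mem_nhds hmem] with z hz
    by_cases h0 : z = 0
    · simp [h0]
    · have := exp_sub_one_ne_zero_of_mem_rightDomain hz h0
      simp only [hf, deriv_logOneSubExpNegDiv hz h0]
      field_simp
      ring
  have hrec : ∀ m : ℕ, ∑ i ∈ Finset.range m, (m.choose i : ℂ) * iteratedDeriv i f 0
      = if m = 1 then 1 else 0 := by
    intro m
    have h1 : iteratedDeriv m (fun z => f z * (exp z - 1)) 0 = if m = 1 then 1 else 0 := by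
      rw [hprod.iteratedDeriv_eq m]
      rcases m with _ | _ | m
      · simp
      · rw [iteratedDeriv_id_mul_zero 0 analyticAt_const]; simp
      · rw [iteratedDeriv_id_mul_zero _ analyticAt_const, iteratedDeriv_succ']; simp
    rw [← h1, iteratedDeriv_fun_mul hfa.contDiffAt (by fun_prop), Finset.sum_range_succ,
      iteratedDeriv_exp_sub_one_zero]
    simp only [Nat.sub_self, if_true, mul_zero, add_zero]
    refine Finset.sum_congr rfl fun i hi => ?_
    have := Finset.mem_range.mp hi
    rw [iteratedDeriv_exp_sub_one_zero, if_neg (by omega), mul_one]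
  induction n using Nat.strong_induction_on with
  | _ n ih =>
    have h1 := hrec (n + 1)
    have h2 := congrArg (fun r : ℚ => (r : ℂ)) (_root_.sum_bernoulli (n + 1))
    push_cast at h2
    simp only [add_eq_right] at h1
    have h5 : ((if n = 0 then 1 else 0 : ℚ) : ℂ) = if n = 0 then 1 else 0 := by split_ifs <;> simp
    simp only [h5] at h2
    rw [Finset.sum_range_succ] at h1 h2
    rw [Finset.sum_congr rfl fun i hi => by rw [ih i (Finset.mem_range.mp hi)]] at h1
    have h3 : ((n + 1).choose n : ℂ) ≠ 0 := by
      rw [Nat.choose_succ_self_right]; exact_mod_cast n.succ_ne_zero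
    have h4 := h1.trans h2.symm
    exact mul_left_cancel₀ h3 (add_left_cancel h4)

theorem iteratedDeriv_succ_logOneSubExpNegDiv_zero (n : ℕ) :
    iteratedDeriv (n + 1) logOneSubExpNegDiv 0 = (bernoulli (n + 1) : ℂ) / (n + 1) := by
  have hmem : (0 : ℂ) ∈ rightDomain := Or.inr (by simp)
  have hb : AnalyticAt ℂ (deriv logOneSubExpNegDiv) 0 := (analyticAt_logOneSubExpNegDiv hmem).deriv
  have h := iteratedDeriv_one_add_id_mul_deriv_zero (n + 1)
  rw [iteratedDeriv_const_add (Nat.succ_pos n), iteratedDeriv_id_mul_zero n hb] at h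
  rw [iteratedDeriv_succ', ← h]
  have : (n : ℂ) + 1 ≠ 0 := by exact_mod_cast n.succ_ne_zero
  field_simp

/-- Near 0 this is compactness; in the sector, ‖e^w - 1‖ ≥ Re w ≥ ‖w‖/K for K > 0. The ball around 0
is allowed besides the sector because Cauchy circles about small points of a sector leave it. -/
theorem exists_norm_deriv_logOneSubExpNegDiv_le {K : ℝ} (hK : 0 ≤ K) :
    ∃ B : ℝ, 0 ≤ B ∧ ∀ w : ℂ, (‖w‖ ≤ 3 / 4 ∨ ‖w‖ ≤ K * w.re) →
      ‖deriv logOneSubExpNegDiv w‖ ≤ B / (1 + ‖w‖) := by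
  have hsub : Metric.closedBall (0 : ℂ) (3 / 4) ⊆ rightDomain := fun z hz =>
    Or.inr (Metric.closedBall_subset_ball (by norm_num) hz)
  obtain ⟨B, hB⟩ := (isCompact_closedBall (0 : ℂ) (3 / 4)).exists_bound_of_continuousOn
    (f := deriv logOneSubExpNegDiv)
    (fun z hz => (analyticAt_logOneSubExpNegDiv (hsub hz)).deriv.continuousAt.continuousWithinAt)
  have hB0 : 0 ≤ B := (norm_nonneg _).trans (hB 0 (Metric.mem_closedBall_self (by norm_num)))
  refine ⟨2 * B + 3 * (1 + K), by positivity, fun w hw => ?_⟩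
  rw [le_div_iff₀ (by positivity)]
  by_cases hw1 : ‖w‖ ≤ 3 / 4
  · have := hB w (by simpa using hw1)
    have h0 := norm_nonneg (deriv logOneSubExpNegDiv w)
    nlinarith
  · have hwK := hw.resolve_left hw1
    push Not at hw1
    have hre : 0 < w.re := by
      by_contra hneg
      push Not at hneg
      nlinarith
    have hw0 : w ≠ 0 := by rintro rfl; simp at hre
    rw [deriv_logOneSubExpNegDiv (Or.inl hre) hw0]
    have hexp : w.re ≤ ‖exp w - 1‖ := by
      have h1 := norm_sub_norm_le (exp w) 1
      rw [norm_exp, norm_one] at h1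
      linarith [Real.add_one_le_exp w.re]
    have hwpos : 0 < ‖w‖ := norm_pos_iff.mpr hw0
    have h2 : ‖1 / (exp w - 1)‖ ≤ K / ‖w‖ := by
      rw [norm_div, norm_one, div_le_div_iff₀ (hre.trans_le hexp) hwpos]
      nlinarith
    have h3 : ‖1 / (exp w - 1) - 1 / w‖ ≤ (1 + K) / ‖w‖ := by
      refine (norm_sub_le _ _).trans ?_
      rw [norm_div 1 w, norm_one, add_div, add_comm]
      gcongr
    calc _ ≤ (1 + K) / ‖w‖ * (1 + ‖w‖) := by gcongr
      _ = (1 + K) * ((1 + ‖w‖) / ‖w‖) := by ring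
      _ ≤ (1 + K) * 3 := by
        gcongr
        rw [div_le_iff₀ hwpos]; linarith
      _ ≤ _ := by linarith

/-- Cauchy's estimate on circles of radius proportional to 1 + ‖z‖: each further derivative gains
one power of decay. -/
theorem exists_norm_iteratedDeriv_logOneSubExpNegDiv_le {K : ℝ} (hK : 0 ≤ K) (j : ℕ) :
    ∃ C : ℝ, 0 ≤ C ∧ ∀ z : ℂ, ‖z‖ ≤ K * z.re →
      ‖iteratedDeriv (j + 1) logOneSubExpNegDiv z‖ ≤ C / (1 + ‖z‖) ^ (j + 1) := by
  obtain ⟨B, hB0, hB⟩ := exists_norm_deriv_logOneSubExpNegDiv_le (K := 2 * K + 1) (by positivity)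
  -- If ‖z‖ ≤ 1/2 then R ≤ 1/4, and the disc lies in the ball of radius 3/4. Otherwise R ≤ 3δ‖z‖ ≤
  -- Re z / 2, and the disc lies in the wider sector with constant 2K + 1.
  set δ : ℝ := 1 / (6 * (K + 1)) with hδ
  have hδ0 : 0 < δ := by positivity
  have hδ6 : δ ≤ 1 / 6 := by
    rw [hδ]; exact one_div_le_one_div_of_le (by norm_num) (by linarith)
  have hδK : δ * K ≤ 1 / 6 := by
    rw [hδ, one_div_mul_eq_div, div_le_div_iff₀ (by positivity) (by norm_num)]; linarith
  refine ⟨j.factorial * (2 * B) / δ ^ j, by positivity, fun z hz => ?_⟩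
  set R : ℝ := δ * (1 + ‖z‖) with hR
  have hz0 := norm_nonneg z
  have hR0 : 0 < R := by positivity
  have hregion : ∀ w ∈ Metric.closedBall z R, (‖w‖ ≤ 3 / 4 ∨
      (0 < w.re ∧ ‖w‖ ≤ (2 * K + 1) * w.re)) ∧ (1 + ‖z‖) / 2 ≤ 1 + ‖w‖ := by
    intro w hw
    rw [mem_closedBall_iff_norm] at hw
    have h1 : ‖w‖ ≤ ‖z‖ + R := by
      have := norm_add_le z (w - z); rw [add_sub_cancel] at this; linarith
    have h2 : ‖z‖ ≤ ‖w‖ + R := by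
      have := norm_sub_le w (w - z); rw [sub_sub_cancel] at this; linarith
    have h3 : z.re - R ≤ w.re := by
      have := (abs_le.mp (abs_re_le_norm (w - z))).1
      rw [sub_re] at this; linarith
    refine ⟨?_, by nlinarith⟩
    by_cases hz1 : ‖z‖ ≤ 1 / 2
    · left; nlinarith
    · right
      push Not at hz1
      have hzre : 0 < z.re := by
        by_contra hneg
        push Not at hneg
        nlinarith
      have h4 : R ≤ z.re / 2 := by
        have h5 : R ≤ 3 * δ * ‖z‖ := by nlinarith
        have h6 : 3 * δ * ‖z‖ ≤ 3 * δ * (K * z.re) := by gcongr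
        nlinarith
      refine ⟨by linarith, ?_⟩
      nlinarith
  have hsub : Metric.closedBall z R ⊆ rightDomain := by
    intro w hw
    rcases (hregion w hw).1 with h | h
    · exact Or.inr (by rw [mem_ball_zero_iff]; linarith)
    · exact Or.inl h.1
  have hdiff : DiffContOnCl ℂ (deriv logOneSubExpNegDiv) (Metric.ball z R) :=
    DifferentiableOn.diffContOnCl_ball (U := rightDomain) (fun w hw =>
      (analyticAt_logOneSubExpNegDiv hw).deriv.differentiableAt.differentiableWithinAt) hsub
  have hbound : ∀ w ∈ Metric.sphere z R, ‖deriv logOneSubExpNegDiv w‖ ≤ 2 * B / (1 + ‖z‖) := by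
    intro w hw
    obtain ⟨h1, h2⟩ := hregion w (Metric.sphere_subset_closedBall hw)
    refine (hB w (h1.imp_right And.right)).trans ?_
    rw [div_le_div_iff₀ (by positivity) (by positivity)]
    nlinarith
  have h := norm_iteratedDeriv_le_of_forall_mem_sphere_norm_le j hR0 hdiff hbound
  rw [iteratedDeriv_succ']
  refine h.trans (le_of_eq ?_)
  rw [hR, mul_pow]
  field_simp
  ring

/-! ### Expansion of weighted logarithmic sums -/

theorem ofReal_mul_re_pos {t : ℂ} (ht : 0 < t.re) {s : ℝ} (hs : 0 < s) :
    0 < ((s : ℂ) * t).re := by simpa using mul_pos hs ht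

theorem ofReal_mul_mem_rightDomain {t : ℂ} (ht : 0 < t.re) {s : ℝ} (hs : 0 ≤ s) :
    (s : ℂ) * t ∈ rightDomain := by
  rcases hs.eq_or_lt with rfl | hs
  · exact Or.inr (by simp)
  · exact Or.inl (ofReal_mul_re_pos ht hs)

theorem logOneSubExpNegDiv_ofReal_mul {t : ℂ} (ht : 0 < t.re) {s : ℝ} (hs : 0 < s) :
    logOneSubExpNegDiv (s * t) = log (1 - exp (-(s * t))) - log s - log t := by
  have ht0 : t ≠ 0 := by rintro rfl; simp at ht
  rw [log_one_sub_exp_neg (ofReal_mul_re_pos ht hs), log_ofReal_mul hs ht0, ofReal_log hs.le]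
  ring

theorem hasDerivAt_ray_iteratedDeriv {t : ℂ} (ht : 0 < t.re) (j : ℕ) {s : ℝ} (hs : 0 ≤ s) :
    HasDerivAt (fun s : ℝ => t ^ j * iteratedDeriv j logOneSubExpNegDiv (s * t))
      (t ^ (j + 1) * iteratedDeriv (j + 1) logOneSubExpNegDiv (s * t)) s := by
  have h1 := hasDerivAt_iteratedDeriv_logOneSubExpNegDiv j (ofReal_mul_mem_rightDomain ht hs)
  have h2 : HasDerivAt (fun u : ℂ => u * t) t (s : ℂ) := by
    simpa using (hasDerivAt_id (s : ℂ)).mul_const t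
  have h3 : HasDerivAt (fun u : ℂ => iteratedDeriv j logOneSubExpNegDiv (u * t))
      (iteratedDeriv (j + 1) logOneSubExpNegDiv (s * t) * t) (s : ℂ) :=
    HasDerivAt.comp (h₂ := iteratedDeriv j logOneSubExpNegDiv) (s : ℂ) h1 h2
  exact (h3.comp_ofReal.const_mul (t ^ j)).congr_deriv (by ring)

/-- The partial sums of `∑ w(m) log (1 - e ^ (- m t))` over whole periods. -/
noncomputable def weightedLogSum (N : ℕ) (w : ℕ → ℂ) (t : ℂ) (n : ℕ) : ℂ :=
  ∑ i ∈ Finset.range n, ∑ k ∈ Finset.Icc 1 N,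
    w k * log (1 - exp (-(((i : ℝ) * N + k : ℝ) * t)))

/-- The renormalized partial sums of `∑ w(m) log m` over whole periods. -/
noncomputable def weightedLogNat (N : ℕ) (w : ℕ → ℂ) (n : ℕ) : ℂ :=
  ∑ i ∈ Finset.range n, ∑ k ∈ Finset.Icc 1 N, w k * log (((i : ℝ) * N + k : ℝ) : ℂ) +
    weightMoment N w 0 * log (((n : ℝ) * N : ℝ) : ℂ)

theorem tendsto_natCast_mul_mul_atTop {N : ℕ} (hN : N ≠ 0) {r : ℝ} (hr : 0 < r) :
    Tendsto (fun n : ℕ => ((n : ℝ) * N) * r) atTop atTop := by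
  have hNr : (0 : ℝ) < N := by exact_mod_cast Nat.pos_of_ne_zero hN
  exact (tendsto_natCast_atTop_atTop.atTop_mul_const hNr).atTop_mul_const hr

/-- Euler–Maclaurin for s ↦ ℓ(st). Convergence of `weightedLogNat` is a by-product; since that
sequence does not involve t, neither does `Z`. -/
theorem exists_norm_sub_weighted_expansion_le {N : ℕ} (hN : N ≠ 0) {w : ℕ → ℂ}
    (hw : ∑ k ∈ Finset.Icc 1 N, w k = 0) {K : ℝ} (hK : 0 ≤ K) (M : ℕ) :
    ∃ C : ℝ, 0 ≤ C ∧ ∀ t : ℂ, 0 < t.re → ‖t‖ ≤ K * t.re → ‖t‖ ≤ 1 → ∀ g : ℂ,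
      Tendsto (weightedLogSum N w t) atTop (𝓝 g) →
      ∃ Z : ℂ, Tendsto (weightedLogNat N w) atTop (𝓝 Z) ∧
        ‖g - Z - weightMoment N w 0 * log t - ∑ j ∈ Finset.range (M + 2),
          weightMoment N w j * (t ^ j * iteratedDeriv j logOneSubExpNegDiv 0)‖ ≤ C * ‖t‖ ^ M := by
  obtain ⟨C, hC0, hC⟩ := exists_norm_iteratedDeriv_logOneSubExpNegDiv_le hK (M + 1)
  refine ⟨eulerMaclaurinConst N w (M + 2) * (C * ∑' n : ℕ, 1 / ((n : ℝ) + 1) ^ 2), ?_, ?_⟩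
  · have := eulerMaclaurinConst_nonneg N w (M + 2)
    have : 0 ≤ ∑' n : ℕ, 1 / ((n : ℝ) + 1) ^ 2 := tsum_nonneg fun n => by positivity
    positivity
  intro t ht htK ht1 g hg
  have hNr : (1 : ℝ) ≤ N := by exact_mod_cast Nat.one_le_iff_ne_zero.mpr hN
  set φ : ℕ → ℝ → ℂ := fun j s => t ^ j * iteratedDeriv j logOneSubExpNegDiv (s * t) with hφ
  have hsector : ∀ s : ℝ, 0 ≤ s → ‖(s : ℂ) * t‖ ≤ K * ((s : ℂ) * t).re := by
    intro s hs
    rw [norm_mul, norm_real, Real.norm_of_nonneg hs, re_ofReal_mul]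
    nlinarith
  have hB : ∀ n : ℕ, ∀ s : ℝ, (n : ℝ) * N ≤ s →
      ‖φ (M + 2) s‖ ≤ C * ‖t‖ ^ M * (1 / ((n : ℝ) + 1) ^ 2) := by
    intro n s hs
    have hn0 : (0 : ℝ) ≤ n := n.cast_nonneg
    have hns : (n : ℝ) ≤ s := by nlinarith
    have hs0 : 0 ≤ s := hn0.trans hns
    have h1 := hC _ (hsector s hs0)
    have hnorm : ‖(s : ℂ) * t‖ = s * ‖t‖ := by rw [norm_mul, norm_real, Real.norm_of_nonneg hs0]
    rw [hnorm] at h1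
    have ht0 := norm_nonneg t
    -- Two of the M + 2 powers of ‖t‖ are traded for the summable factor 1/(n+1)², so the error is
    -- of order ‖t‖^M.
    have h2 : ‖t‖ * (n + 1) ≤ 1 + s * ‖t‖ := by nlinarith
    have h3 : (‖t‖ * (n + 1)) ^ 2 ≤ (1 + s * ‖t‖) ^ (M + 1 + 1) :=
      (pow_le_pow_left₀ (by positivity) h2 2).trans
        (pow_le_pow_right₀ (by nlinarith [mul_nonneg hs0 ht0]) (by omega))
    simp only [hφ, norm_mul, norm_pow]
    calc ‖t‖ ^ (M + 2) * ‖iteratedDeriv (M + 2) logOneSubExpNegDiv (s * t)‖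
        ≤ ‖t‖ ^ (M + 2) * (C / (1 + s * ‖t‖) ^ (M + 1 + 1)) := by gcongr
      _ ≤ C * ‖t‖ ^ M * (1 / ((n : ℝ) + 1) ^ 2) := by
        rw [← mul_div_assoc, mul_one_div, div_le_div_iff₀ (by positivity) (by positivity)]
        have : ‖t‖ ^ (M + 2) * C * ((n : ℝ) + 1) ^ 2 = C * ‖t‖ ^ M * (‖t‖ * (n + 1)) ^ 2 := by ring
        rw [this]
        gcongr
  have hBs : Summable fun n : ℕ => C * ‖t‖ ^ M * (1 / ((n : ℝ) + 1) ^ 2) := by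
    refine Summable.mul_left _ ?_
    exact_mod_cast (summable_nat_add_iff 1).mpr
      (Real.summable_one_div_nat_pow.mpr (by norm_num : 1 < 2))
  obtain ⟨A, hA, hAle⟩ := exists_tendsto_weighted_eulerMaclaurin hN hw (M := M + 2) (φ := φ)
    (fun j _ s hs => hasDerivAt_ray_iteratedDeriv ht j hs) hB hBs
  have ht0 : 0 < ‖t‖ := norm_pos_iff.mpr (by rintro rfl; simp at ht)
  have hdecay : ∀ j : ℕ, Tendsto (fun n : ℕ => φ (j + 1) ((n : ℝ) * N)) atTop (𝓝 0) := by
    intro j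
    obtain ⟨D, hD0, hD⟩ := exists_norm_iteratedDeriv_logOneSubExpNegDiv_le hK j
    have hlim : Tendsto (fun n : ℕ => ‖t‖ ^ (j + 1) * (D / (1 + (n : ℝ) * N * ‖t‖))) atTop (𝓝 0) := by
      rw [← mul_zero (‖t‖ ^ (j + 1))]
      exact ((tendsto_atTop_add_const_left _ 1
        (tendsto_natCast_mul_mul_atTop hN ht0)).const_div_atTop D).const_mul _
    refine squeeze_zero_norm (fun n => ?_) hlim
    have hs0 : 0 ≤ (n : ℝ) * N := by positivity
    have h1 := hD _ (hsector _ hs0)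
    rw [norm_mul, norm_real, Real.norm_of_nonneg hs0] at h1
    simp only [hφ, norm_mul, norm_pow]
    gcongr
    refine h1.trans ?_
    gcongr
    exact le_self_pow₀ (by nlinarith [mul_nonneg hs0 ht0.le]) (by omega)
  have hlog : Tendsto (fun n : ℕ => log (1 - exp (-(((n : ℝ) * N : ℝ) * t)))) atTop (𝓝 0) := by
    have h1 : Tendsto (fun n : ℕ => exp (-(((n : ℝ) * N : ℝ) * t))) atTop (𝓝 0) := by
      rw [tendsto_zero_iff_norm_tendsto_zero]
      simp only [norm_exp, neg_re, re_ofReal_mul]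
      exact Real.tendsto_exp_neg_atTop_nhds_zero.comp (tendsto_natCast_mul_mul_atTop hN ht)
    have h2 : Tendsto (fun n : ℕ => 1 - exp (-(((n : ℝ) * N : ℝ) * t))) atTop (𝓝 1) := by
      simpa using h1.const_sub 1
    simpa [Function.comp_def] using
      (continuousAt_clog (by simp : (1 : ℂ) ∈ slitPlane)).tendsto.comp h2
  set d := weightMoment N w
  have hrest : Tendsto (fun n : ℕ => d 0 * log (1 - exp (-(((n : ℝ) * N : ℝ) * t))) +
      ∑ j ∈ Finset.range (M + 1), d (j + 1) * φ (j + 1) ((n : ℝ) * N)) atTop (𝓝 0) := by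
    have h1 := tendsto_finsetSum (Finset.range (M + 1)) fun j _ => (hdecay j).const_mul (d (j + 1))
    simpa using (hlog.const_mul (d 0)).add h1
  -- Inside each period log t cancels because the weights sum to zero. It survives only in the
  -- boundary term `d 0 * φ 0 (n N)`, which yields d_0 log t and the renormalization d_0 log(nN).
  have hZ : Tendsto (weightedLogNat N w) atTop (𝓝 (g - A - d 0 * log t)) := by
    have h1 := ((hg.sub hA).sub_const (d 0 * log t)).add hrest
    rw [add_zero] at h1
    refine h1.congr' ?_
    filter_upwards [eventually_gt_atTop 0] with n hn
    have hper : ∀ i : ℕ, ∑ k ∈ Finset.Icc 1 N, w k * φ 0 ((i : ℝ) * N + k) =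
        ∑ k ∈ Finset.Icc 1 N, w k * log (1 - exp (-(((i : ℝ) * N + k : ℝ) * t))) -
          ∑ k ∈ Finset.Icc 1 N, w k * log (((i : ℝ) * N + k : ℝ) : ℂ) := by
      intro i
      have h2 : ∑ k ∈ Finset.Icc 1 N, w k * log t = 0 := by rw [← Finset.sum_mul, hw, zero_mul]
      rw [← Finset.sum_sub_distrib, ← add_zero (∑ k ∈ Finset.Icc 1 N, _), ← h2,
        ← Finset.sum_add_distrib]
      refine Finset.sum_congr rfl fun k hk => ?_
      have hk := (Finset.mem_Icc.mp hk).1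
      have hpos : 0 < (i : ℝ) * N + k := by positivity
      simp only [hφ, pow_zero, one_mul, iteratedDeriv_zero, logOneSubExpNegDiv_ofReal_mul ht hpos]
      ring
    have hlast : φ 0 ((n : ℝ) * N) = log (1 - exp (-(((n : ℝ) * N : ℝ) * t))) -
        log (((n : ℝ) * N : ℝ) : ℂ) - log t := by
      have hpos : 0 < (n : ℝ) * N := by positivity
      simp only [hφ, pow_zero, one_mul, iteratedDeriv_zero, logOneSubExpNegDiv_ofReal_mul ht hpos]
    simp_rw [hper, Finset.sum_sub_distrib]
    rw [Finset.sum_range_succ' _ (M + 1), hlast, weightedLogNat, weightedLogSum]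
    ring
  refine ⟨_, hZ, ?_⟩
  have h0 : ∑ j ∈ Finset.range (M + 2), d j * φ j 0 = ∑ j ∈ Finset.range (M + 2),
      d j * (t ^ j * iteratedDeriv j logOneSubExpNegDiv 0) := by simp [hφ]
  rw [h0] at hAle
  have h1 : g - (g - A - d 0 * log t) - d 0 * log t = A := by ring
  rw [h1]
  refine hAle.trans (le_of_eq ?_)
  rw [tsum_mul_left]
  ring

/-! ### The asymptotic expansion of 𝔤 -/

theorem sum_Icc_natCast_zmod {N : ℕ} [NeZero N] {A : Type*} [AddCommMonoid A] (f : ZMod N → A) :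
    ∑ k ∈ Finset.Icc 1 N, f (k : ZMod N) = ∑ x : ZMod N, f x := by
  have h1 : ∀ g : ZMod N → A, ∑ k ∈ Finset.range N, g (k : ZMod N) = ∑ x : ZMod N, g x := by
    intro g
    refine Finset.sum_bij' (fun k _ => (k : ZMod N)) (fun x _ => x.val) (by simp)
      (fun x _ => Finset.mem_range.mpr x.val_lt) (fun k hk => ?_) (by simp) (by simp)
    exact ZMod.val_cast_of_lt (Finset.mem_range.mp hk)
  have h2 := Finset.sum_Ico_add' (fun k : ℕ => f (k : ZMod N)) 0 N 1
  rw [zero_add, Finset.Ico_add_one_right_eq_Icc, ← Finset.range_eq_Ico] at h2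
  rw [← h2]
  push_cast
  rw [h1 fun x => f (x + 1)]
  exact Equiv.sum_comp (Equiv.addRight (1 : ZMod N)) f

theorem DirichletCharacter.IsPrimitive.ne_one {N : ℕ} [NeZero N] (hN : 2 ≤ N)
    {χ : DirichletCharacter ℂ N} (hχ : χ.IsPrimitive) : χ ≠ 1 := by
  rintro rfl
  have h := hχ
  rw [DirichletCharacter.isPrimitive_def, DirichletCharacter.conductor_one] at h
  omega

theorem sum_Icc_dirichletCharacter_eq_zero {N : ℕ} [NeZero N] {χ : DirichletCharacter ℂ N}
    (hχ : χ ≠ 1) : ∑ k ∈ Finset.Icc 1 N, χ (k : ZMod N) = 0 := by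
  rw [sum_Icc_natCast_zmod (fun x => χ x)]
  exact MulChar.sum_eq_zero_of_ne_one hχ

theorem tendsto_weightedLogSum {N : ℕ} [NeZero N] (χ : DirichletCharacter ℂ N) {y : ℂ}
    (hy : 0 < y.im) :
    Tendsto (weightedLogSum N (fun k => χ (k : ZMod N)) (-(2 * Real.pi * I * y))) atTop
      (𝓝 (weightedG χ y)) := by
  set t : ℂ := -(2 * Real.pi * I * y) with ht
  have htre : 0 < t.re := by
    have : t.re = 2 * Real.pi * y.im := by simp [ht]
    rw [this]; positivity
  have hN : (0 : ℝ) < N := by exact_mod_cast NeZero.pos N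
  have hterm : ∀ i k : ℕ, nome y ^ k * (nome y ^ N) ^ i = exp (-(((i : ℝ) * N + k : ℝ) * t)) := by
    intro i k
    rw [nome, ← exp_nat_mul, ← exp_nat_mul, ← exp_nat_mul, ← exp_add]
    congr 1
    push_cast
    rw [ht]; ring
  have hnorm : ‖nome y ^ N‖ < 1 := by
    have h := hterm 1 0
    simp only [pow_zero, one_mul, pow_one] at h
    rw [h, norm_exp, Real.exp_lt_one_iff, neg_re, re_ofReal_mul]
    simpa using mul_pos hN htre
  have hsum : ∀ k : ℕ, HasSum (fun i : ℕ => log (1 - exp (-(((i : ℝ) * N + k : ℝ) * t))))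
      (logQPochhammer (nome y ^ k) (nome y ^ N)) := by
    intro k
    have h1 : Summable fun i : ℕ => -(nome y ^ k * (nome y ^ N) ^ i) :=
      ((summable_geometric_of_norm_lt_one hnorm).mul_left _).neg
    have h2 := (Complex.summable_log_one_add_of_summable h1).hasSum
    simp only [← sub_eq_add_neg] at h2
    simp only [← hterm]
    exact h2
  have h := tendsto_finsetSum (Finset.Icc 1 N) fun k _ =>
    (hsum k).tendsto_sum_nat.const_mul (χ (k : ZMod N))
  refine h.congr fun n => ?_
  simp_rw [weightedLogSum, Finset.mul_sum]
  exact Finset.sum_comm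

/-- The asymptotic expansion of `𝔤`, up to its constant term. -/
noncomputable def weightedGExpansion {N : ℕ} (χ : DirichletCharacter ℂ N) (γ : ℂ) :
    FormalExpansion where
  polar := 0
  logCoeff := weightMoment N (fun k => χ (k : ZMod N)) 0
  const := γ
  coeff n := weightMoment N (fun k => χ (k : ZMod N)) (n + 1) * (-(2 * Real.pi * I)) ^ (n + 1) *
    ((bernoulli (n + 1) : ℂ) / (n + 1))

theorem hasAsymptoticExpansion_weightedGExpansion {N : ℕ} [NeZero N] {χ : DirichletCharacter ℂ N}
    (hχ : χ ≠ 1) : ∃ γ, HasAsymptoticExpansion (weightedG χ) (weightedGExpansion χ γ) := by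
  have hw := sum_Icc_dirichletCharacter_eq_zero hχ
  have hN := NeZero.ne N
  set w : ℕ → ℂ := fun k => χ (k : ZMod N) with hwdef
  -- The constant does not depend on t, so it may be found at the single point y = i/(2π), where t =
  -- 1.
  obtain ⟨γ, hγ⟩ : ∃ γ, Tendsto (weightedLogNat N w) atTop (𝓝 γ) := by
    obtain ⟨C, -, hC⟩ := exists_norm_sub_weighted_expansion_le hN hw (K := 1) zero_le_one 0
    have hy : 0 < (I / (2 * Real.pi : ℝ)).im := by
      rw [div_ofReal_im, I_im]; positivity
    have h1 : -(2 * Real.pi * I * (I / (2 * Real.pi : ℝ))) = 1 := by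
      have : (Real.pi : ℂ) ≠ 0 := by exact_mod_cast Real.pi_ne_zero
      push_cast; field_simp; simp
    have h2 := tendsto_weightedLogSum χ hy
    rw [h1] at h2
    obtain ⟨Z, hZ, -⟩ := hC 1 (by simp) (by simp) (by simp) _ h2
    exact ⟨Z, hZ⟩
  refine ⟨γ, fun c M => ?_⟩
  obtain ⟨C, hC0, hC⟩ := exists_norm_sub_weighted_expansion_le hN hw (K := 1 + |c|)
    (by positivity) (M + 1)
  set d := weightMoment N w with hd
  set e : ℕ → ℂ := fun j => d j * iteratedDeriv j logOneSubExpNegDiv 0 with he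
  refine IsBigO.of_bound (C * (2 * Real.pi) ^ (M + 1) +
    (‖e (M + 1)‖ * (2 * Real.pi) ^ (M + 1) + ‖e (M + 2)‖ * (2 * Real.pi) ^ (M + 1))) ?_
  have hsmall : ∀ᶠ y : ℂ in 𝓝[closedSubsector c] 0, ‖y‖ < 1 / (2 * Real.pi) := by
    refine nhdsWithin_le_nhds ?_
    have := Metric.ball_mem_nhds (0 : ℂ) (ε := 1 / (2 * Real.pi)) (by positivity)
    filter_upwards [this] with y hy
    simpa using hy
  filter_upwards [hsmall, self_mem_nhdsWithin] with y hy1 hy2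
  obtain ⟨him, hre⟩ := hy2
  set t : ℂ := -(2 * Real.pi * I * y) with ht
  have htre : t.re = 2 * Real.pi * y.im := by simp [ht]
  have htnorm : ‖t‖ = 2 * Real.pi * ‖y‖ := by
    simp [ht, abs_of_pos Real.pi_pos]
  have ht1 : ‖t‖ ≤ 1 := by
    rw [htnorm]
    have h2 : 0 < 2 * Real.pi := by positivity
    calc 2 * Real.pi * ‖y‖ ≤ 2 * Real.pi * (1 / (2 * Real.pi)) := by gcongr
      _ = 1 := by field_simp
  have htK : ‖t‖ ≤ (1 + |c|) * t.re := by
    rw [htnorm, htre]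
    have h3 : ‖y‖ ≤ (1 + |c|) * y.im := by
      refine (norm_le_abs_re_add_abs_im y).trans ?_
      rw [abs_of_pos him]
      nlinarith [le_abs_self c]
    have := Real.pi_pos
    nlinarith
  obtain ⟨Z, hZ, hle⟩ := hC t (by rw [htre]; positivity) htK ht1 _ (tendsto_weightedLogSum χ him)
  rw [tendsto_nhds_unique hZ hγ] at hle
  have hcoeff : ∀ n, (weightedGExpansion χ γ).coeff n * y ^ (n + 1) = e (n + 1) * t ^ (n + 1) := by
    intro n
    have : t = -(2 * Real.pi * I) * y := by rw [ht]; ring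
    rw [he, this, mul_pow]
    simp only [iteratedDeriv_succ_logOneSubExpNegDiv_zero, weightedGExpansion, ← hwdef, ← hd]
    ring
  -- The estimate of order M + 1 includes terms up to t^{M+2}. The j = 0 term vanishes as ℓ(0) = 0,
  -- and the two terms beyond t^M go into the remainder.
  have hsplit : weightedG χ y - (weightedGExpansion χ γ).truncation M y =
      (weightedG χ y - γ - d 0 * log t - ∑ j ∈ Finset.range (M + 1 + 2),
        d j * (t ^ j * iteratedDeriv j logOneSubExpNegDiv 0)) +
      (e (M + 1) * t ^ (M + 1) + e (M + 2) * t ^ (M + 2)) := by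
    have h0 : d 0 * (t ^ 0 * iteratedDeriv 0 logOneSubExpNegDiv 0) = 0 := by
      simp [logOneSubExpNegDiv_zero]
    have h1 : ∀ j, d j * (t ^ j * iteratedDeriv j logOneSubExpNegDiv 0) = e j * t ^ j := by
      intro j; rw [he]; ring
    rw [Finset.sum_range_succ', h0]
    simp_rw [h1]
    rw [Finset.sum_range_succ, Finset.sum_range_succ, FormalExpansion.truncation]
    simp_rw [hcoeff]
    simp only [weightedGExpansion, ← hwdef, ← hd, ← ht, zero_div]
    ring
  rw [hsplit, norm_pow]
  clear_value e
  have ht0 := norm_nonneg t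
  have hpow : ‖t‖ ^ (M + 1) = (2 * Real.pi) ^ (M + 1) * ‖y‖ ^ (M + 1) := by rw [htnorm, mul_pow]
  refine (norm_add_le _ _).trans ?_
  rw [add_mul, mul_assoc C, ← hpow]
  refine add_le_add hle ((norm_add_le _ _).trans ?_)
  rw [add_mul, mul_assoc ‖e (M + 1)‖, mul_assoc ‖e (M + 2)‖, ← hpow, norm_mul, norm_mul, norm_pow,
    norm_pow]
  exact add_le_add le_rfl (mul_le_mul_of_nonneg_left
    (pow_le_pow_of_le_one ht0 ht1 (Nat.le_succ (M + 1))) (norm_nonneg _))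

/-! ### Uniqueness of the expansion -/

theorem tendsto_I_mul_ofReal_closedSubsector :
    Tendsto (fun x : ℝ => I * x) (𝓝[>] 0) (𝓝[closedSubsector 0] 0) := by
  refine tendsto_nhdsWithin_iff.mpr ⟨?_, ?_⟩
  · have h : Continuous fun x : ℝ => I * (x : ℂ) := by fun_prop
    simpa using (h.tendsto 0).mono_left nhdsWithin_le_nhds
  · filter_upwards [self_mem_nhdsWithin] with x hx
    have hx : (0 : ℝ) < x := hx
    simpa [closedSubsector] using hx

theorem FormalExpansion.truncation_sub (E₁ E₂ : FormalExpansion) (M : ℕ) (y : ℂ) :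
    E₁.truncation M y - E₂.truncation M y = (E₁.polar - E₂.polar) / y +
      (E₁.logCoeff - E₂.logCoeff) * log (-(2 * Real.pi * I * y)) + (E₁.const - E₂.const) +
      ∑ n ∈ Finset.range M, (E₁.coeff n - E₂.coeff n) * y ^ (n + 1) := by
  simp only [FormalExpansion.truncation, sub_mul, Finset.sum_sub_distrib]
  ring

/-- On the ray y = ix the logarithm is the real log(2πx), and the scales 1/x, log x, 1, x, x², … are
each negligible against the previous one. The coefficients of the difference are removed in this
order. -/
theorem HasAsymptoticExpansion.unique {f : ℂ → ℂ} {E₁ E₂ : FormalExpansion}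
    (h₁ : HasAsymptoticExpansion f E₁) (h₂ : HasAsymptoticExpansion f E₂) : E₁ = E₂ := by
  obtain ⟨p₁, l₁, c₁, a₁⟩ := E₁
  obtain ⟨p₂, l₂, c₂, a₂⟩ := E₂
  have hdiff : ∀ M : ℕ, (fun x : ℝ => (p₁ - p₂) / (I * x) +
      (l₁ - l₂) * (Real.log (2 * Real.pi * x) : ℂ) + (c₁ - c₂) +
      ∑ n ∈ Finset.range M, (a₁ n - a₂ n) * (I * x) ^ (n + 1)) =O[𝓝[>] 0]
        fun x : ℝ => x ^ (M + 1) := by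
    intro M
    have h := (((h₂ 0 M).sub (h₁ 0 M)).comp_tendsto tendsto_I_mul_ofReal_closedSubsector).norm_right
    simp only [Function.comp_def, sub_sub_sub_cancel_left, FormalExpansion.truncation_sub] at h
    refine (h.congr' ?_ ?_)
    · filter_upwards [self_mem_nhdsWithin] with x hx
      have hx : (0 : ℝ) < x := hx
      have : -(2 * Real.pi * I * (I * x)) = ((2 * Real.pi * x : ℝ) : ℂ) := by
        push_cast; linear_combination (-2 * Real.pi * x : ℂ) * I_mul_I
      rw [this, ofReal_log (by positivity)]
    · filter_upwards [self_mem_nhdsWithin] with x hx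
      have hx : (0 : ℝ) < x := hx
      simp [abs_of_pos hx]
  have hid : Tendsto (fun x : ℝ => x) (𝓝[>] 0) (𝓝 0) := tendsto_id.mono_left nhdsWithin_le_nhds
  have hpi : Tendsto (fun x : ℝ => 2 * Real.pi * x) (𝓝[>] 0) (𝓝[>] 0) := by
    refine tendsto_nhdsWithin_iff.mpr ⟨by simpa using hid.const_mul (2 * Real.pi), ?_⟩
    filter_upwards [self_mem_nhdsWithin] with x hx
    have hx : (0 : ℝ) < x := hx
    exact (by positivity : (0 : ℝ) < 2 * Real.pi * x)
  have h0 : Tendsto (fun x : ℝ => (p₁ - p₂) / (I * x) +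
      (l₁ - l₂) * (Real.log (2 * Real.pi * x) : ℂ) + (c₁ - c₂)) (𝓝[>] 0) (𝓝 0) := by
    have h := (hdiff 0).trans_tendsto (by simpa using hid)
    simpa using h
  have hidC : Tendsto (fun x : ℝ => (x : ℂ)) (𝓝[>] 0) (𝓝 0) :=
    (continuous_ofReal.tendsto' 0 0 ofReal_zero).comp hid
  have hp : p₁ - p₂ = 0 := by
    have hxlog : Tendsto (fun x : ℝ => (x : ℂ) * (Real.log (2 * Real.pi * x) : ℂ)) (𝓝[>] 0)
        (𝓝 0) := by
      have h1 := (tendsto_log_mul_rpow_nhdsGT_zero one_pos).comp hpi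
      have h3 := h1.div_const (2 * Real.pi)
      rw [zero_div] at h3
      have h2 := (continuous_ofReal.tendsto' 0 0 ofReal_zero).comp h3
      refine h2.congr fun x => ?_
      have : (Real.pi : ℂ) ≠ 0 := by exact_mod_cast Real.pi_ne_zero
      simp only [Function.comp_apply, Real.rpow_one]
      push_cast
      field_simp
    have h1 := (hidC.mul h0).sub ((hxlog.const_mul (l₁ - l₂)).add (hidC.mul_const (c₁ - c₂)))
    simp only [mul_zero, zero_mul, add_zero, sub_zero] at h1
    have h2 : Tendsto (fun _ : ℝ => (p₁ - p₂) / I) (𝓝[>] 0) (𝓝 0) := by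
      refine h1.congr' ?_
      filter_upwards [self_mem_nhdsWithin] with x hx
      have hx : (x : ℂ) ≠ 0 := by exact_mod_cast (show (0 : ℝ) < x from hx).ne'
      have := I_ne_zero
      field_simp
      ring
    simpa using tendsto_nhds_unique tendsto_const_nhds h2
  have hl : l₁ - l₂ = 0 := by
    have hlog : Tendsto (fun x : ℝ => (Real.log (2 * Real.pi * x))⁻¹) (𝓝[>] 0) (𝓝 0) :=
      tendsto_inv_atBot_zero.comp (Real.tendsto_log_nhdsGT_zero.comp hpi)
    have hlogC : Tendsto (fun x : ℝ => ((Real.log (2 * Real.pi * x) : ℂ))⁻¹) (𝓝[>] 0) (𝓝 0) := by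
      have := (continuous_ofReal.tendsto' 0 0 ofReal_zero).comp hlog
      simpa [Function.comp_def] using this
    have hne : ∀ᶠ x : ℝ in 𝓝[>] 0, Real.log (2 * Real.pi * x) ≠ 0 :=
      (Real.tendsto_log_nhdsGT_zero.comp hpi).eventually (eventually_ne_atBot 0)
    have h1 := (h0.mul hlogC).sub (hlogC.const_mul (c₁ - c₂))
    simp only [mul_zero, sub_zero] at h1
    have h2 : Tendsto (fun _ : ℝ => l₁ - l₂) (𝓝[>] 0) (𝓝 0) := by
      refine h1.congr' ?_
      filter_upwards [hne] with x hx
      have hx : (Real.log (2 * Real.pi * x) : ℂ) ≠ 0 := by exact_mod_cast hx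
      rw [hp]
      field_simp
      ring
    exact tendsto_nhds_unique tendsto_const_nhds h2
  have hc : c₁ - c₂ = 0 := by
    simp only [hp, hl, zero_div, zero_mul, zero_add] at h0
    exact tendsto_nhds_unique tendsto_const_nhds h0
  have ha : ∀ n, a₁ n - a₂ n = 0 := by
    intro n
    induction n using Nat.strong_induction_on with
    | _ n ih =>
      have h := hdiff (n + 1)
      simp only [hp, hl, hc, zero_div, zero_mul, zero_add] at h
      have hsum : ∀ x : ℝ, ∑ m ∈ Finset.range (n + 1), (a₁ m - a₂ m) * (I * x) ^ (m + 1)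
          = (a₁ n - a₂ n) * (I * x) ^ (n + 1) := by
        intro x
        rw [Finset.sum_range_succ, Finset.sum_eq_zero, zero_add]
        intro m hm
        rw [ih m (Finset.mem_range.mp hm), zero_mul]
      simp only [hsum] at h
      obtain ⟨C, hC⟩ := h.bound
      have hle : ∀ᶠ x : ℝ in 𝓝[>] 0, ‖a₁ n - a₂ n‖ ≤ C * x := by
        filter_upwards [hC, self_mem_nhdsWithin] with x hx hx0
        have hx0 : (0 : ℝ) < x := hx0
        have hpos : 0 < x ^ (n + 1) := by positivity
        simp only [norm_mul, norm_pow, norm_I, one_mul, norm_real, Real.norm_of_nonneg hx0.le]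
          at hx
        refine le_of_mul_le_mul_right ?_ hpos
        calc _ ≤ _ := hx
          _ = _ := by ring
      have := ge_of_tendsto (by simpa using hid.const_mul C) hle
      simpa using this
  simp only [FormalExpansion.mk.injEq]
  exact ⟨sub_eq_zero.mp hp, sub_eq_zero.mp hl, sub_eq_zero.mp hc,
    funext fun n => sub_eq_zero.mp (ha n)⟩

/-! ### Twisted divisor sums and their Dirichlet series -/

/-- The arithmetic function `d ↦ ψ(d) / d`. -/
noncomputable def charDivId {N : ℕ} (ψ : DirichletCharacter ℂ N) : ArithmeticFunction ℂ :=
  ⟨fun d => ψ (d : ZMod N) / (d : ℂ), by simp⟩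

/-- The arithmetic function `m ↦ ∑_{d ∣ m} ψ(d) / d`. -/
noncomputable def charSigma {N : ℕ} (ψ : DirichletCharacter ℂ N) : ArithmeticFunction ℂ :=
  charDivId ψ * (ArithmeticFunction.zeta : ArithmeticFunction ℂ)

theorem charDivId_apply {N : ℕ} (ψ : DirichletCharacter ℂ N) (d : ℕ) :
    charDivId ψ d = ψ (d : ZMod N) / (d : ℂ) := rfl

theorem charSigma_apply {N : ℕ} (ψ : DirichletCharacter ℂ N) (m : ℕ) :
    charSigma ψ m = ∑ d ∈ m.divisors, ψ (d : ZMod N) / (d : ℂ) := by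
  rw [charSigma, ArithmeticFunction.coe_mul_zeta_apply]; rfl

theorem isMultiplicative_charDivId {N : ℕ} (ψ : DirichletCharacter ℂ N) :
    (charDivId ψ).IsMultiplicative := by
  refine ⟨by simp [charDivId_apply], fun {m n} _ => ?_⟩
  simp only [charDivId_apply, Nat.cast_mul, map_mul]
  rw [mul_div_mul_comm]

theorem isMultiplicative_charSigma {N : ℕ} (ψ : DirichletCharacter ℂ N) :
    (charSigma ψ).IsMultiplicative :=
  (isMultiplicative_charDivId ψ).mul ArithmeticFunction.isMultiplicative_zeta.natCast

/-- The value is a geometric sum of ratio ρ = ψ(p)/p; if it vanished, then ρ^{k+1} = 1, against |ρ|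
< 1. -/
theorem charSigma_prime_pow_ne_zero {N : ℕ} (ψ : DirichletCharacter ℂ N) {p : ℕ} (hp : p.Prime)
    (k : ℕ) : charSigma ψ (p ^ k) ≠ 0 := by
  have h1 : charSigma ψ (p ^ k) = ∑ i ∈ Finset.range (k + 1), (ψ (p : ZMod N) / (p : ℂ)) ^ i := by
    rw [charSigma_apply, Nat.sum_divisors_prime_pow hp]
    simp [div_pow]
  have hlt : ‖ψ (p : ZMod N) / (p : ℂ)‖ < 1 := by
    have hp1 : (1 : ℝ) < p := by exact_mod_cast hp.one_lt
    rw [norm_div, norm_natCast, div_lt_one (by positivity)]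
    exact (ψ.norm_le_one _).trans_lt hp1
  rw [h1]
  intro h0
  have h2 := geom_sum_mul (ψ (p : ZMod N) / (p : ℂ)) (k + 1)
  rw [h0, zero_mul] at h2
  have h3 : ‖(ψ (p : ZMod N) / (p : ℂ)) ^ (k + 1)‖ < 1 := by
    rw [norm_pow]; exact pow_lt_one₀ (norm_nonneg _) hlt (by omega)
  rw [sub_eq_zero.mp h2.symm, norm_one] at h3
  exact lt_irrefl _ h3

theorem charSigma_ne_zero {N : ℕ} (ψ : DirichletCharacter ℂ N) {m : ℕ} (hm : m ≠ 0) :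
    charSigma ψ m ≠ 0 := by
  rw [(isMultiplicative_charSigma ψ).multiplicative_factorization _ hm, Finsupp.prod,
    Finset.prod_ne_zero_iff]
  intro p hp
  exact charSigma_prime_pow_ne_zero ψ (Nat.prime_of_mem_primeFactors (by simpa using hp)) _

theorem charSigma_one {N : ℕ} (ψ : DirichletCharacter ℂ N) : charSigma ψ 1 = 1 :=
  (isMultiplicative_charSigma ψ).1

theorem LSeriesHasSum_charSigma {N : ℕ} [NeZero N] (ψ : DirichletCharacter ℂ N) {s : ℂ}
    (hs : 1 < s.re) :
    LSeriesHasSum (charSigma ψ) s (ψ.LFunction (s + 1) * riemannZeta s) := by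
  have hs1 : 1 < (s + 1).re := by simp; linarith
  have h1 : LSeriesHasSum (charDivId ψ) s (ψ.LFunction (s + 1)) := by
    rw [ψ.LFunction_eq_LSeries hs1]
    have h2 := (ψ.LSeriesSummable_of_one_lt_re hs1).LSeriesHasSum
    refine HasSum.congr_fun (f := LSeries.term (fun n : ℕ => ψ (n : ZMod N)) (s + 1)) h2 ?_
    intro n
    rcases eq_or_ne n 0 with rfl | hn
    · simp
    · have hnC : (n : ℂ) ≠ 0 := Nat.cast_ne_zero.mpr hn
      rw [LSeries.term_of_ne_zero hn, LSeries.term_of_ne_zero hn, charDivId_apply,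
        cpow_add _ _ hnC, cpow_one, div_div, mul_comm (n : ℂ)]
  rw [charSigma, ← ArithmeticFunction.coe_mul]
  refine h1.convolution ?_
  have := (ArithmeticFunction.LSeriesSummable_zeta_iff.mpr hs).LSeriesHasSum
  rw [ArithmeticFunction.LSeries_zeta_eq_riemannZeta hs] at this
  exact this

theorem stokesG_eq {N : ℕ} [NeZero N] (χ : DirichletCharacter ℂ N) (m : ℤ) :
    stokesG χ m = -(1 - χ (-1)) * charGaussSum χ * charSigma χ⁻¹ m.natAbs := by
  rw [stokesG, charSigma_apply]

/-! ### Gauss sums and special values -/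

/-- Primitivity makes this hold for every j, including those not coprime to N. -/
theorem sum_char_mul_fourier {N : ℕ} [NeZero N] {χ : DirichletCharacter ℂ N}
    (hχ : χ.IsPrimitive) (j : ℤ) :
    ∑ k ∈ Finset.Icc 1 N, χ (k : ZMod N) * fourier j (((k : ℝ) / N : ℝ) : UnitAddCircle)
      = χ⁻¹ (j : ZMod N) * charGaussSum χ := by
  rw [charGaussSum, ← gaussSum_mulShift_of_isPrimitive _ hχ, gaussSum,
    ← sum_Icc_natCast_zmod fun x => χ x * (ZMod.stdAddChar.mulShift (j : ZMod N)) x]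
  refine Finset.sum_congr rfl fun k _ => ?_
  have h : (j : ZMod N) * (k : ZMod N) = ((j * k : ℤ) : ZMod N) := by push_cast; rfl
  rw [AddChar.mulShift_apply, h, ZMod.stdAddChar_coe, fourier_coe_apply]
  congr 2
  push_cast
  ring

theorem DirichletCharacter.inv_apply_neg {N : ℕ} (χ : DirichletCharacter ℂ N) (x : ZMod N) :
    χ⁻¹ (-x) = χ (-1) * χ⁻¹ x := by
  have h : χ⁻¹ (-1) = χ (-1) := by
    rw [MulChar.inv_apply]
    congr 1
    have := Ring.inverse_unit (-1 : (ZMod N)ˣ)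
    simpa using this
  rw [← h, ← map_mul, neg_one_mul]

/-- Sum the Fourier series of B_p at k/N against χ. Frequencies n and -n contribute χ⁻¹(n) G(χ) and
-χ(-1) χ⁻¹(n) G(χ), as p is odd. -/
theorem gaussSum_mul_LFunction_eq_sum_bernoulliFun {N : ℕ} [NeZero N] {χ : DirichletCharacter ℂ N}
    (hχ : χ.IsPrimitive) {p : ℕ} (hp : 2 ≤ p) (hodd : Odd p) :
    (1 - χ (-1)) * charGaussSum χ * DirichletCharacter.LFunction χ⁻¹ p =
      -(2 * Real.pi * I) ^ p / (p.factorial : ℂ) *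
        ∑ k ∈ Finset.Icc 1 N, χ (k : ZMod N) * (bernoulliFun p ((k : ℝ) / N) : ℂ) := by
  have h1 := hasSum_sum (s := Finset.Icc 1 N) fun k hk =>
    (hasSum_one_div_nat_pow_mul_fourier hp (x := (k : ℝ) / N) ⟨by positivity, by
      have : (k : ℝ) ≤ N := by exact_mod_cast (Finset.mem_Icc.mp hk).2
      exact div_le_one_of_le₀ this (by positivity)⟩).mul_left (χ (k : ZMod N))
  have hs : 1 < ((p : ℂ)).re := by
    rw [natCast_re]; exact_mod_cast hp
  have h2 := ((χ⁻¹).LSeriesSummable_of_one_lt_re hs).LSeriesHasSum.mul_left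
    ((1 - χ (-1)) * charGaussSum χ)
  rw [← (χ⁻¹).LFunction_eq_LSeries hs] at h2
  have h3 := h2.unique (h1.congr_fun ?_)
  · rw [h3, Finset.mul_sum]
    exact Finset.sum_congr rfl fun k _ => by ring
  intro n
  have h4 : ∑ k ∈ Finset.Icc 1 N, χ (k : ZMod N) * ((1 : ℂ) / (n : ℂ) ^ p *
      (fourier (n : ℤ) (((k : ℝ) / N : ℝ) : UnitAddCircle) +
        (-1 : ℂ) ^ p * fourier (-(n : ℤ)) (((k : ℝ) / N : ℝ) : UnitAddCircle))) =
      1 / (n : ℂ) ^ p * (∑ k ∈ Finset.Icc 1 N,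
        χ (k : ZMod N) * fourier (n : ℤ) (((k : ℝ) / N : ℝ) : UnitAddCircle) -
      ∑ k ∈ Finset.Icc 1 N,
        χ (k : ZMod N) * fourier (-(n : ℤ)) (((k : ℝ) / N : ℝ) : UnitAddCircle)) := by
    rw [hodd.neg_one_pow, ← Finset.sum_sub_distrib, Finset.mul_sum]
    exact Finset.sum_congr rfl fun k _ => by ring
  rw [h4, sum_char_mul_fourier hχ, sum_char_mul_fourier hχ]
  push_cast
  rw [DirichletCharacter.inv_apply_neg]
  rcases eq_or_ne n 0 with rfl | hn
  · have : p ≠ 0 := by omega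
    simp [this]
  · rw [LSeries.term_of_ne_zero hn, cpow_natCast]
    ring

theorem two_mul_riemannZeta_eq_bernoulli {k : ℕ} (hk : 2 ≤ k) (heven : Even k) :
    2 * riemannZeta k = -(2 * Real.pi * I) ^ k / (k.factorial : ℂ) * (bernoulli k : ℂ) := by
  have h1 := hasSum_one_div_nat_pow_mul_fourier hk (x := 0) (by simp)
  have h2 : HasSum (fun n : ℕ => 1 / (n : ℂ) ^ k) (riemannZeta k) := by
    rw [zeta_nat_eq_tsum_of_gt_one (by omega)]
    refine Summable.hasSum ?_
    have := Complex.summable_one_div_nat_cpow (p := k)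
    simp only [cpow_natCast, natCast_re] at this
    exact this.mpr (by exact_mod_cast hk)
  have h3 := (h2.mul_left 2).unique (h1.congr_fun fun n => by
    rw [heven.neg_one_pow]; simp; ring)
  rw [h3, bernoulliFun_eval_zero]
  push_cast; rfl

/-! ### Sums of simple poles and Borel transforms -/

/-- The function `∑ m, T m * (1 / (m - w) - 1 / (m + w))`, with simple poles at the integers. -/
noncomputable def symmetricPoleSum (T : ℕ → ℂ) (w : ℂ) : ℂ :=
  ∑' m : ℕ, T m * (1 / (m - w) - 1 / (m + w))

section SymmetricPoleSum

variable {T : ℕ → ℂ} {w₀ : ℂ} {r : ℝ}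

/-- Pairing ±m gives 2w/(m² - w²), whence the quadratic decay for the Weierstrass test. Separation
is asked only where `T m ≠ 0`, so the bound also applies at a pole once its coefficient is set to 0.
-/
theorem norm_symmetricPole_le (hr : 0 < r)
    (h : ∀ m : ℕ, T m ≠ 0 → m ≠ 0 ∧ 2 * r ≤ ‖m - w₀‖ ∧ 2 * r ≤ ‖m + w₀‖) {w : ℂ}
    (hw : w ∈ Metric.ball w₀ r) (m : ℕ) :
    ‖T m * (1 / (m - w) - 1 / (m + w))‖ ≤
      2 * (‖w₀‖ + r) * (1 + (‖w₀‖ + r) / r) ^ 2 * (‖T m‖ / (m : ℝ) ^ 2) := by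
  by_cases hT : T m = 0
  · simp [hT]
  obtain ⟨hm, h1, h2⟩ := h m hT
  rw [mem_ball_iff_norm] at hw
  have hwn : ‖w‖ ≤ ‖w₀‖ + r := by
    have := norm_add_le w₀ (w - w₀); rw [add_sub_cancel] at this; linarith
  have hmpos : (0 : ℝ) < m := by exact_mod_cast Nat.pos_of_ne_zero hm
  have hκ : ∀ u : ℂ, r ≤ ‖u‖ → (m : ℝ) ≤ ‖u‖ + (‖w₀‖ + r) →
      (m : ℝ) ≤ ‖u‖ * (1 + (‖w₀‖ + r) / r) := by
    intro u hu hmu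
    have h3 : ‖w₀‖ + r ≤ ‖u‖ * ((‖w₀‖ + r) / r) := by
      rw [← mul_div_assoc, le_div_iff₀ hr, mul_comm]
      have := norm_nonneg w₀
      gcongr
    linarith
  have hA1 : r ≤ ‖(m : ℂ) - w‖ := by
    have := norm_sub_le ((m : ℂ) - w) (w₀ - w)
    rw [sub_sub_sub_cancel_right, norm_sub_rev w₀] at this; linarith
  have hA2 : r ≤ ‖(m : ℂ) + w‖ := by
    have := norm_sub_le ((m : ℂ) + w) (w - w₀)
    rw [show (m : ℂ) + w - (w - w₀) = m + w₀ by ring] at this; linarith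
  have hB1 : (m : ℝ) ≤ ‖(m : ℂ) - w‖ + (‖w₀‖ + r) := by
    have := norm_add_le ((m : ℂ) - w) w
    rw [sub_add_cancel, Complex.norm_natCast] at this; linarith
  have hB2 : (m : ℝ) ≤ ‖(m : ℂ) + w‖ + (‖w₀‖ + r) := by
    have := norm_sub_le ((m : ℂ) + w) w
    rw [add_sub_cancel_right, Complex.norm_natCast] at this; linarith
  have hC1 := hκ _ hA1 hB1
  have hC2 := hκ _ hA2 hB2
  set κ := 1 + (‖w₀‖ + r) / r
  have hp1 : 0 < ‖(m : ℂ) - w‖ := hr.trans_le hA1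
  have hp2 : 0 < ‖(m : ℂ) + w‖ := hr.trans_le hA2
  have hn1 := norm_pos_iff.mp hp1
  have hn2 := norm_pos_iff.mp hp2
  have heq : (1 : ℂ) / (m - w) - 1 / (m + w) = 2 * w / ((m - w) * (m + w)) := by
    field_simp; ring
  rw [heq, norm_mul, norm_div, norm_mul, norm_mul, Complex.norm_ofNat]
  have h4 : (m : ℝ) ^ 2 ≤ κ ^ 2 * (‖(m : ℂ) - w‖ * ‖(m : ℂ) + w‖) := by
    calc (m : ℝ) ^ 2 = m * m := sq _
      _ ≤ (‖(m : ℂ) - w‖ * κ) * (‖(m : ℂ) + w‖ * κ) := by gcongr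
      _ = _ := by ring
  have h5 : 2 * ‖w‖ / (‖(m : ℂ) - w‖ * ‖(m : ℂ) + w‖) ≤
      2 * (‖w₀‖ + r) * (κ ^ 2 / (m : ℝ) ^ 2) := by
    rw [← mul_div_assoc, div_le_div_iff₀ (by positivity) (by positivity)]
    calc 2 * ‖w‖ * (m : ℝ) ^ 2
        ≤ 2 * (‖w₀‖ + r) * (κ ^ 2 * (‖(m : ℂ) - w‖ * ‖(m : ℂ) + w‖)) := by gcongr
      _ = _ := by ring
  calc ‖T m‖ * (2 * ‖w‖ / (‖(m : ℂ) - w‖ * ‖(m : ℂ) + w‖))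
      ≤ ‖T m‖ * (2 * (‖w₀‖ + r) * (κ ^ 2 / (m : ℝ) ^ 2)) := by gcongr
    _ = _ := by ring

theorem summable_symmetricPole (hT : Summable fun m : ℕ => ‖T m‖ / (m : ℝ) ^ 2) (hr : 0 < r)
    (h : ∀ m : ℕ, T m ≠ 0 → m ≠ 0 ∧ 2 * r ≤ ‖m - w₀‖ ∧ 2 * r ≤ ‖m + w₀‖) {w : ℂ}
    (hw : w ∈ Metric.ball w₀ r) :
    Summable fun m : ℕ => T m * (1 / (m - w) - 1 / (m + w)) :=
  Summable.of_norm_bounded (hT.mul_left _) fun m => norm_symmetricPole_le hr h hw m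

theorem analyticAt_symmetricPoleSum (hT : Summable fun m : ℕ => ‖T m‖ / (m : ℝ) ^ 2) (hr : 0 < r)
    (h : ∀ m : ℕ, T m ≠ 0 → m ≠ 0 ∧ 2 * r ≤ ‖m - w₀‖ ∧ 2 * r ≤ ‖m + w₀‖) :
    AnalyticAt ℂ (symmetricPoleSum T) w₀ := by
  have hd : DifferentiableOn ℂ (symmetricPoleSum T) (Metric.ball w₀ r) := by
    refine differentiableOn_tsum_of_summable_norm (hT.mul_left _) (fun m => ?_) Metric.isOpen_ball
      fun m w hw => norm_symmetricPole_le hr h hw m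
    by_cases hTm : T m = 0
    · simp only [hTm, zero_mul]; exact differentiableOn_const _
    obtain ⟨-, h1, h2⟩ := h m hTm
    intro w hw
    rw [mem_ball_iff_norm] at hw
    have hn1 : (m : ℂ) - w ≠ 0 := by
      intro h0
      rw [sub_eq_zero.mp h0] at h1; linarith
    have hn2 : (m : ℂ) + w ≠ 0 := by
      intro h0
      rw [eq_neg_of_add_eq_zero_left h0, neg_add_eq_sub, norm_sub_rev] at h2; linarith
    exact (DifferentiableAt.const_mul (((differentiableAt_const _).div
      ((differentiableAt_const _).sub differentiableAt_id) hn1).sub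
      ((differentiableAt_const _).div ((differentiableAt_const _).add differentiableAt_id) hn2))
      _).differentiableWithinAt
  exact hd.analyticAt (Metric.ball_mem_nhds _ hr)

theorem exists_separation_of_ne_int (h0 : T 0 = 0) (h : ∀ m : ℤ, m ≠ 0 → w₀ ≠ m) :
    ∃ r : ℝ, 0 < r ∧ ∀ m : ℕ, T m ≠ 0 → m ≠ 0 ∧ 2 * r ≤ ‖m - w₀‖ ∧ 2 * r ≤ ‖m + w₀‖ := by
  have hclosed : IsClosed (Set.range fun m : {m : ℤ // m ≠ 0} => ((m : ℤ) : ℂ)) := by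
    have h1 : Topology.IsClosedEmbedding ((↑) : ℤ → ℂ) := Complex.isClosedEmbedding_intCast
    have h2 : Set.range (fun m : {m : ℤ // m ≠ 0} => ((m : ℤ) : ℂ)) = (↑) '' {m : ℤ | m ≠ 0} := by
      ext z; simp
    rw [h2]
    exact h1.isClosedMap _ (isClosed_discrete _)
  have hmem : w₀ ∈ (Set.range fun m : {m : ℤ // m ≠ 0} => ((m : ℤ) : ℂ))ᶜ := by
    rintro ⟨⟨m, hm⟩, hmw⟩
    exact h m hm hmw.symm
  obtain ⟨ε, hε, hball⟩ := Metric.isOpen_iff.mp hclosed.isOpen_compl w₀ hmem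
  have hdist : ∀ m : ℤ, m ≠ 0 → ε ≤ ‖(m : ℂ) - w₀‖ := by
    intro m hm
    by_contra hlt
    push Not at hlt
    exact hball (mem_ball_iff_norm.mpr hlt) ⟨⟨m, hm⟩, rfl⟩
  refine ⟨ε / 2, by positivity, fun m hTm => ?_⟩
  have hm : m ≠ 0 := by rintro rfl; exact hTm h0
  refine ⟨hm, ?_, ?_⟩
  · have := hdist m (by exact_mod_cast hm)
    push_cast at this; linarith
  · have := hdist (-m) (by simpa using hm)
    push_cast at this
    rw [← norm_neg, neg_sub, sub_neg_eq_add, add_comm] at this; linarith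

theorem separation_update_natAbs (h0 : T 0 = 0) (m₀ : ℤ) (m : ℕ)
    (hm : Function.update T m₀.natAbs 0 m ≠ 0) :
    m ≠ 0 ∧ 2 * (1 / 2 : ℝ) ≤ ‖(m : ℂ) - m₀‖ ∧ 2 * (1 / 2 : ℝ) ≤ ‖(m : ℂ) + m₀‖ := by
  have hne : m ≠ m₀.natAbs := by
    rintro rfl; simp at hm
  have hm0 : m ≠ 0 := by
    rintro rfl
    rw [Function.update_of_ne hne] at hm
    exact hm h0
  have key : ∀ k : ℤ, k ≠ 0 → 2 * (1 / 2 : ℝ) ≤ ‖(k : ℂ)‖ := by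
    intro k hk
    rw [Complex.norm_intCast]
    have : (1 : ℤ) ≤ |k| := Int.one_le_abs hk
    have : (1 : ℝ) ≤ |(k : ℝ)| := by exact_mod_cast this
    linarith
  refine ⟨hm0, ?_, ?_⟩
  · have := key (m - m₀) (by omega); push_cast at this; exact this
  · have := key (m + m₀) (by omega); push_cast at this; exact this

theorem summable_update (hT : Summable fun m : ℕ => ‖T m‖ / (m : ℝ) ^ 2) (n : ℕ) :
    Summable fun m : ℕ => ‖Function.update T n 0 m‖ / (m : ℝ) ^ 2 := by
  refine Summable.of_nonneg_of_le (fun m => by positivity) (fun m => ?_) hT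
  rcases eq_or_ne m n with rfl | h
  · simp only [Function.update_self, norm_zero, zero_div]; positivity
  · rw [Function.update_of_ne h]

/-- The paired term is invariant under m ↦ -m, so one splitting isolates the pole at a positive or a
negative integer. -/
theorem symmetricPoleSum_eq_add_update (hT : Summable fun m : ℕ => ‖T m‖ / (m : ℝ) ^ 2)
    (h0 : T 0 = 0) (m₀ : ℤ) {w : ℂ} (hw : w ∈ Metric.ball (m₀ : ℂ) (1 / 2)) :
    symmetricPoleSum T w = T m₀.natAbs * (1 / (m₀ - w) - 1 / (m₀ + w)) +
      symmetricPoleSum (Function.update T m₀.natAbs 0) w := by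
  have h1 := (summable_symmetricPole (summable_update hT m₀.natAbs) (by norm_num)
    (separation_update_natAbs h0 m₀) hw).hasSum
  have h2 := (hasSum_ite_eq m₀.natAbs
    (T m₀.natAbs * (1 / ((m₀.natAbs : ℂ) - w) - 1 / ((m₀.natAbs : ℂ) + w)))).add h1
  have h3 : (1 : ℂ) / ((m₀.natAbs : ℂ) - w) - 1 / ((m₀.natAbs : ℂ) + w) =
      1 / (m₀ - w) - 1 / (m₀ + w) := by
    rcases Int.natAbs_eq m₀ with h | h
    · rw [← Int.cast_natCast, ← h]
    · have h4 : ((m₀.natAbs : ℕ) : ℂ) = -(m₀ : ℂ) := by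
        rw [← Int.cast_natCast, ← Int.cast_neg]; congr 1; omega
      rw [h4, ← neg_add', neg_add_eq_sub, ← neg_sub (m₀ : ℂ) w, div_neg, div_neg]; ring
  rw [← h3]
  refine (HasSum.congr_fun h2 fun m => ?_).tsum_eq
  rcases eq_or_ne m m₀.natAbs with rfl | hm
  · simp
  · simp [hm]

theorem hasSum_symmetricPole_powerSeries {w : ℂ} (hw : ‖w‖ < 1) {m : ℕ} (hm : m ≠ 0) :
    HasSum (fun n : ℕ => w ^ n * ((1 - (-1) ^ n) / (m : ℂ) ^ (n + 1)))
      (1 / ((m : ℂ) - w) - 1 / ((m : ℂ) + w)) := by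
  have hmC : (m : ℂ) ≠ 0 := Nat.cast_ne_zero.mpr hm
  have hm1 : (1 : ℝ) ≤ m := by exact_mod_cast Nat.one_le_iff_ne_zero.mpr hm
  have key : ∀ u : ℂ, ‖u‖ < 1 → HasSum (fun n : ℕ => u ^ n / (m : ℂ) ^ (n + 1))
      (1 / ((m : ℂ) - u)) := by
    intro u hu
    have hlt : ‖u / (m : ℂ)‖ < 1 := by
      rw [norm_div, Complex.norm_natCast, div_lt_one (by linarith)]; linarith
    have h1 := (hasSum_geometric_of_norm_lt_one hlt).mul_left (1 / (m : ℂ))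
    have hne : (m : ℂ) - u ≠ 0 := by
      intro h0
      rw [← sub_eq_zero.mp h0, Complex.norm_natCast] at hu; linarith
    have h2 : 1 / (m : ℂ) * (1 - u / m)⁻¹ = 1 / ((m : ℂ) - u) := by
      have : 1 - u / (m : ℂ) = (m - u) / m := by field_simp
      rw [this]; field_simp
    rw [h2] at h1
    refine h1.congr_fun fun n => ?_
    rw [div_pow, pow_succ]; field_simp
  have h := (key w hw).sub (key (-w) (by rwa [norm_neg]))
  rw [sub_neg_eq_add] at h
  refine h.congr_fun fun n => ?_
  rw [neg_pow]; ring

/-- Exchange of a double sum. The n = 0 terms vanish, and for n ≥ 1 the exponent n + 1 ≥ 2 gives the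
majorant 2 ‖T m‖ ‖w‖^n / m². -/
theorem hasSum_symmetricPoleSum (hT : Summable fun m : ℕ => ‖T m‖ / (m : ℝ) ^ 2) (h0 : T 0 = 0)
    {c : ℕ → ℂ} (hc : ∀ n : ℕ, n ≠ 0 →
      HasSum (fun m : ℕ => T m * ((1 - (-1) ^ n) / (m : ℂ) ^ (n + 1))) (c n))
    {w : ℂ} (hw : ‖w‖ < 1) :
    HasSum (fun n : ℕ => if n = 0 then 0 else c n * w ^ n) (symmetricPoleSum T w) := by
  set f : ℕ × ℕ → ℂ := fun p => T p.1 * (w ^ p.2 * ((1 - (-1) ^ p.2) / (p.1 : ℂ) ^ (p.2 + 1)))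
    with hf
  have hsum : Summable f := by
    have h1 : Summable fun p : ℕ × ℕ => (‖T p.1‖ / (p.1 : ℝ) ^ 2) * (2 * ‖w‖ ^ p.2) :=
      hT.mul_of_nonneg ((summable_geometric_of_lt_one (norm_nonneg w) hw).mul_left 2)
        (fun m => by positivity) (fun n => by positivity)
    refine Summable.of_norm_bounded h1 fun ⟨m, n⟩ => ?_
    rcases eq_or_ne m 0 with rfl | hm
    · simp [hf, h0]
    rcases eq_or_ne n 0 with rfl | hn
    · simp only [hf, pow_zero, sub_self, zero_div, mul_zero, norm_zero]; positivity
    have hm1 : (1 : ℝ) ≤ m := by exact_mod_cast Nat.one_le_iff_ne_zero.mpr hm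
    have h2 : ‖(1 : ℂ) - (-1) ^ n‖ ≤ 2 := by
      refine (norm_sub_le _ _).trans ?_
      simp only [norm_one, norm_pow, norm_neg, one_pow]; norm_num
    have h3 : (m : ℝ) ^ 2 ≤ (m : ℝ) ^ (n + 1) := pow_le_pow_right₀ hm1 (by omega)
    simp only [hf, norm_mul, norm_div, norm_pow, Complex.norm_natCast]
    calc ‖T m‖ * (‖w‖ ^ n * (‖(1 : ℂ) - (-1) ^ n‖ / (m : ℝ) ^ (n + 1)))
        ≤ ‖T m‖ * (‖w‖ ^ n * (2 / (m : ℝ) ^ 2)) := by gcongr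
      _ = _ := by ring
  have hrow := hsum.hasSum.prod_fiberwise (g := fun m : ℕ => T m * (1 / ((m : ℂ) - w) -
      1 / ((m : ℂ) + w))) fun m => by
    rcases eq_or_ne m 0 with rfl | hm
    · simp [hf, h0]
    · exact (hasSum_symmetricPole_powerSeries hw hm).mul_left (T m)
  have hcol := ((Equiv.prodComm ℕ ℕ).hasSum_iff.mpr hsum.hasSum).prod_fiberwise
    (g := fun n : ℕ => if n = 0 then 0 else c n * w ^ n) fun n => by
    rcases eq_or_ne n 0 with rfl | hn
    · simp [hf]
    · rw [if_neg hn]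
      refine ((hc n hn).mul_right (w ^ n)).congr_fun fun m => ?_
      simp only [hf, Function.comp_apply, Equiv.prodComm_apply, Prod.swap_prod_mk]
      ring
  rw [symmetricPoleSum, hrow.tsum_eq]
  exact hcol

end SymmetricPoleSum

/-- The coefficient a_0 is unconstrained: it only adds a constant to the Borel transform. -/
theorem hasStokesTower_of_hasSum {a : ℕ → ℂ} {ω : ℂ} (hω : ω ≠ 0) {S : ℤ → ℂ}
    (hS0 : S 0 = 0) (hSabs : ∀ m : ℤ, S m = S m.natAbs)
    (hS : Summable fun m : ℕ => ‖S m‖ / (m : ℝ) ^ 2)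
    (ha : ∀ n : ℕ, n ≠ 0 →
      HasSum (fun m : ℕ => S m / (2 * Real.pi * I) * ((1 - (-1) ^ n) / (m : ℂ) ^ (n + 1)))
        (a n / (n.factorial : ℂ) * ω ^ (n + 1))) :
    HasStokesTower a ω S := by
  set T : ℕ → ℂ := fun m => S m / (2 * Real.pi * I) with hTdef
  have hT0 : T 0 = 0 := by simp [hTdef, hS0]
  have hT : Summable fun m : ℕ => ‖T m‖ / (m : ℝ) ^ 2 := by
    refine (hS.mul_right ‖(2 * Real.pi * I : ℂ)‖⁻¹).congr fun m => ?_
    rw [hTdef, norm_div]; ring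
  have hquot : ∀ ζ : ℂ, AnalyticAt ℂ (fun ζ : ℂ => ζ / ω) ζ := fun ζ =>
    analyticAt_id.div analyticAt_const hω
  refine ⟨fun ζ => a 0 + 1 / ω * symmetricPoleSum T (ζ / ω), ⟨?_, ?_⟩, ?_⟩
  · have hball : Metric.ball (0 : ℂ) ‖ω‖ ∈ 𝓝 0 :=
      Metric.ball_mem_nhds 0 (norm_pos_iff.mpr hω)
    filter_upwards [hball] with ζ hζ
    rw [mem_ball_zero_iff] at hζ
    have hw : ‖ζ / ω‖ < 1 := by rwa [norm_div, div_lt_one (norm_pos_iff.mpr hω)]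
    have h1 := (hasSum_ite_eq (0 : ℕ) (a 0)).add
      ((hasSum_symmetricPoleSum hT hT0 ha hw).mul_left (1 / ω))
    refine h1.congr_fun fun n => ?_
    rcases eq_or_ne n 0 with rfl | hn
    · simp
    · simp only [hn, if_false, zero_add, div_pow]
      field_simp
      ring
  · intro ζ hζ
    obtain ⟨r, hr, hsep⟩ := exists_separation_of_ne_int (w₀ := ζ / ω) hT0 fun m hm h =>
      hζ m hm ((div_eq_iff hω).mp h)
    exact analyticAt_const.add (analyticAt_const.mul
      (AnalyticAt.comp (f := fun ζ : ℂ => ζ / ω) (analyticAt_symmetricPoleSum hT hr hsep)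
        (hquot ζ)))
  · intro m hm
    have hmC : (m : ℂ) ≠ 0 := Int.cast_ne_zero.mpr hm
    have hmω : (m : ℂ) * ω / ω = m := by field_simp
    refine ⟨fun ζ => a 0 + 1 / ω * (symmetricPoleSum (Function.update T m.natAbs 0) (ζ / ω) -
      T m.natAbs * (1 / (m + ζ / ω))), ?_, ?_⟩
    · refine analyticAt_const.add (analyticAt_const.mul (AnalyticAt.sub ?_ ?_))
      · refine AnalyticAt.comp (g := symmetricPoleSum _) (f := fun ζ : ℂ => ζ / ω) ?_ (hquot _)
        rw [hmω]
        exact analyticAt_symmetricPoleSum (summable_update hT _) (by norm_num)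
          (separation_update_natAbs hT0 m)
      · refine analyticAt_const.mul (analyticAt_const.div (analyticAt_const.add (hquot _)) ?_)
        rw [hmω, ← two_mul]
        exact mul_ne_zero two_ne_zero hmC
    · have hcont : Tendsto (fun ζ : ℂ => ζ / ω) (𝓝[≠] (m * ω)) (𝓝 (m : ℂ)) := by
        have := (hquot (m * ω)).continuousAt.tendsto
        rw [hmω] at this
        exact this.mono_left nhdsWithin_le_nhds
      filter_upwards [hcont (Metric.ball_mem_nhds _ (by norm_num : (0 : ℝ) < 1 / 2)),
        self_mem_nhdsWithin] with ζ hζ hne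
      have hne : ζ ≠ m * ω := hne
      rw [symmetricPoleSum_eq_add_update hT hT0 m hζ]
      have h1 : ζ - m * ω ≠ 0 := sub_ne_zero.mpr hne
      have h2 : (m : ℂ) - ζ / ω = -(ζ - m * ω) / ω := by field_simp; ring
      have h3 : T m.natAbs = S m / (2 * Real.pi * I) := by rw [hTdef, hSabs m]
      have h4 : (1 : ℂ) / ω * (T m.natAbs * (1 / (m - ζ / ω))) =
          -S m / (2 * Real.pi * I * (ζ - m * ω)) := by
        rw [h2, h3]
        have := two_pi_I_ne_zero
        field_simp
      rw [← h4]
      ring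

/-- The terms of a convergent power series are bounded at a nonzero point of its disc. -/
theorem IsBorelContinuation.isGevreyOne {a : ℕ → ℂ} {U : Set ℂ} {F : ℂ → ℂ}
    (h : IsBorelContinuation a U F) : IsGevreyOne a := by
  obtain ⟨ε, hε, hball⟩ := Metric.eventually_nhds_iff_ball.mp h.1
  have hmem : ((ε / 2 : ℝ) : ℂ) ∈ Metric.ball (0 : ℂ) ε := by
    rw [mem_ball_zero_iff, norm_real, Real.norm_of_nonneg (by positivity)]; linarith
  have hlim := (hball _ hmem).summable.tendsto_atTop_zero.norm
  obtain ⟨C, hC⟩ := hlim.bddAbove_range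
  refine ⟨C, ε / 2, by positivity, fun n => ?_⟩
  have h1 := hC ⟨n, rfl⟩
  simp only [norm_mul, norm_div, norm_pow, norm_real, Complex.norm_natCast,
    Real.norm_of_nonneg (by positivity : 0 ≤ ε / 2)] at h1
  have hfac : (0 : ℝ) < n.factorial := by exact_mod_cast n.factorial_pos
  have hpow : 0 < (ε / 2) ^ n := by positivity
  rw [div_mul_eq_mul_div, div_le_iff₀ hfac, ← le_div_iff₀ hpow] at h1
  refine h1.trans (le_of_eq ?_)
  rw [one_div, inv_pow]
  field_simp

/-- The complement of the countable set of poles is connected, so F is the constant a_0 on it.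
Multiplying by ζ - A and letting ζ → A forces S_1 = 0. -/
theorem not_hasStokesTower_of_eq_zero {a : ℕ → ℂ} (ha : ∀ n, n ≠ 0 → a n = 0) {A : ℂ}
    (hA : A ≠ 0) {S : ℤ → ℂ} (hS : S 1 ≠ 0) : ¬ HasStokesTower a A S := by
  rintro ⟨F, ⟨hF0, hF⟩, hpole⟩
  set U : Set ℂ := {ζ | ∀ m : ℤ, m ≠ 0 → ζ ≠ m * A} with hU
  have hUc : IsPreconnected U := by
    have hcount : (Set.range fun m : {m : ℤ // m ≠ 0} => (m : ℂ) * A).Countable :=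
      Set.countable_range _
    have h1 := (hcount.isConnected_compl_of_one_lt_rank (by simp)).isPreconnected
    have h2 : U = (Set.range fun m : {m : ℤ // m ≠ 0} => (m : ℂ) * A)ᶜ := by
      ext ζ
      simp only [hU, Set.mem_ofPred_eq, Set.mem_compl_iff, Set.mem_range, Subtype.exists,
        not_exists]
      exact ⟨fun h m hm he => h m hm he.symm, fun h m hm he => h m hm he.symm⟩
    rwa [h2]
  have h0U : (0 : ℂ) ∈ U := fun m hm h =>
    mul_ne_zero (Int.cast_ne_zero.mpr hm) hA h.symm
  have hloc : F =ᶠ[𝓝 0] fun _ => a 0 := by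
    filter_upwards [hF0] with ζ hζ
    refine hζ.unique ?_
    convert hasSum_ite_eq (0 : ℕ) (a 0) using 2 with n
    split_ifs with hn
    · simp [hn]
    · simp [ha n hn]
  have hconst : Set.EqOn F (fun _ => a 0) U :=
    AnalyticOnNhd.eqOn_of_preconnected_of_eventuallyEq hF analyticOnNhd_const hUc h0U hloc
  obtain ⟨h, hh, hFh⟩ := hpole 1 one_ne_zero
  rw [Int.cast_one, one_mul] at hh hFh
  have hnear : ∀ᶠ ζ in 𝓝[≠] A, ζ ∈ U := by
    have hb := Metric.ball_mem_nhds A (norm_pos_iff.mpr hA)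
    filter_upwards [nhdsWithin_le_nhds hb, self_mem_nhdsWithin] with ζ hζ hne m hm he
    rw [mem_ball_iff_norm, he] at hζ
    by_cases hm1 : m = 1
    · exact hne (by rw [he, hm1]; simp)
    · have h1 : ‖(m : ℂ) * A - A‖ = ‖((m - 1 : ℤ) : ℂ)‖ * ‖A‖ := by
        rw [← norm_mul]; push_cast; congr 1; ring
      have h2 : (1 : ℝ) ≤ ‖((m - 1 : ℤ) : ℂ)‖ := by
        rw [Complex.norm_intCast]
        exact_mod_cast Int.one_le_abs (sub_ne_zero.mpr hm1)
      rw [h1] at hζ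
      nlinarith [norm_pos_iff.mpr hA]
  have hlim : Tendsto (fun ζ => (ζ - A) * (a 0 - h ζ)) (𝓝[≠] A) (𝓝 0) := by
    have h1 : ContinuousAt (fun ζ => (ζ - A) * (a 0 - h ζ)) A :=
      (continuousAt_id.sub continuousAt_const).mul (continuousAt_const.sub hh.continuousAt)
    have h2 := h1.tendsto
    simp only [sub_self, zero_mul] at h2
    exact h2.mono_left nhdsWithin_le_nhds
  have hlim2 : Tendsto (fun _ : ℂ => -S 1 / (2 * Real.pi * I)) (𝓝[≠] A) (𝓝 0) := by
    refine hlim.congr' ?_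
    filter_upwards [hnear, hFh, self_mem_nhdsWithin] with ζ hζ hζ2 hne
    have h1 : ζ - A ≠ 0 := sub_ne_zero.mpr hne
    have h2 := two_pi_I_ne_zero
    rw [hconst hζ] at hζ2
    have h3 : a 0 - h ζ = -S 1 / (2 * Real.pi * I * (ζ - A)) := sub_eq_of_eq_add hζ2
    rw [h3]
    field_simp
  have hfin := tendsto_nhds_unique tendsto_const_nhds hlim2
  rw [div_eq_zero_iff, neg_eq_zero] at hfin
  exact hfin.elim hS two_pi_I_ne_zero

/-! ### The L-function property -/

theorem meromorphicOn_riemannZeta : MeromorphicOn riemannZeta Set.univ := by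
  intro s _
  by_cases hs : s = 1
  · subst hs
    have hg : AnalyticAt ℂ (Function.update (fun s => (s - 1) * riemannZeta s) 1 1) 1 := by
      refine analyticAt_of_differentiable_on_punctured_nhds_of_continuousAt ?_
        (continuousAt_update_same.mpr riemannZeta_residue_one)
      filter_upwards [self_mem_nhdsWithin] with z hz
      have hz : z ≠ 1 := hz
      refine DifferentiableAt.congr_of_eventuallyEq (f := fun s => (s - 1) * riemannZeta s)
        ((differentiableAt_id.sub_const 1).mul (differentiableAt_riemannZeta hz)) ?_
      filter_upwards [isOpen_ne.mem_nhds hz] with u hu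
      exact Function.update_of_ne hu _ _
    have hid : MeromorphicAt (fun s : ℂ => s - 1) 1 := by fun_prop
    refine (hg.meromorphicAt.div hid).congr ?_
    filter_upwards [self_mem_nhdsWithin] with z hz
    have hz : z ≠ 1 := hz
    have := sub_ne_zero.mpr hz
    rw [Pi.div_apply, Function.update_of_ne hz]
    field_simp
  · have hd : DifferentiableOn ℂ riemannZeta {1}ᶜ := fun z hz =>
      (differentiableAt_riemannZeta hz).differentiableWithinAt
    exact (hd.analyticAt (isOpen_compl_singleton.mem_nhds hs)).meromorphicAt

/-- Multiplicativity gives the Euler product. The continuation is c L(s+1, ψ) ζ(s), whose first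
factor is entire since ψ ≠ 1. -/
theorem isLFunctionCoeff_charSigma {N : ℕ} [NeZero N] {ψ : DirichletCharacter ℂ N} (hψ : ψ ≠ 1)
    {c : ℂ} (hc : c ≠ 0) : IsLFunctionCoeff fun m => c * charSigma ψ m := by
  have hsum : ∀ s : ℂ, 1 < s.re → LSeriesHasSum (fun m => c * charSigma ψ m) s
      (c * (ψ.LFunction (s + 1) * riemannZeta s)) := fun s hs =>
    (LSeriesHasSum_charSigma ψ hs).smul c
  refine ⟨1, zero_le_one, by simpa [charSigma_one] using hc, fun s hs => ⟨(hsum s hs).LSeriesSummable,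
    ?_⟩, fun s => c * (ψ.LFunction (s + 1) * riemannZeta s), ?_, fun s hs => (hsum s hs).LSeries_eq.symm⟩
  · have hL := LSeriesHasSum_charSigma ψ hs
    have hprod := EulerProduct.eulerProduct_hasProd (f := LSeries.term (charSigma ψ) s) ?_ ?_
      hL.LSeriesSummable.norm (LSeries.term_zero ..)
    · have h1 : LSeries (fun m => c * charSigma ψ m) s / (c * charSigma ψ 1) =
          ∑' n, LSeries.term (charSigma ψ) s n := by
        rw [(hsum s hs).LSeries_eq, ← hL.LSeries_eq, charSigma_one, LSeries]
        field_simp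
      rw [h1]
      refine hprod.congr_fun fun p => tsum_congr fun k => ?_
      have hp : (p : ℕ) ^ k ≠ 0 := pow_ne_zero _ p.prop.ne_zero
      rw [LSeries.term_of_ne_zero hp]
      dsimp only
      rw [charSigma_one, mul_one, mul_div_cancel_left₀ _ hc]
    · rw [LSeries.term_of_ne_zero one_ne_zero, charSigma_one]; simp
    · intro m n hmn
      rcases eq_or_ne m 0 with rfl | hm
      · simp
      rcases eq_or_ne n 0 with rfl | hn
      · simp
      rw [LSeries.term_of_ne_zero hm, LSeries.term_of_ne_zero hn,
        LSeries.term_of_ne_zero (mul_ne_zero hm hn), (isMultiplicative_charSigma ψ).2 hmn,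
        Nat.cast_mul, natCast_mul_natCast_cpow]
      rw [mul_div_mul_comm]
  · intro s _
    have h1 : Differentiable ℂ fun s => ψ.LFunction (s + 1) :=
      (DirichletCharacter.differentiable_LFunction hψ).comp (differentiable_id.add_const 1)
    exact (MeromorphicAt.const c s).mul ((h1.analyticAt s).meromorphicAt.mul
      (meromorphicOn_riemannZeta s (Set.mem_univ s)))

/-! ### Stokes constants of 𝔤 and the conclusion -/

/-- The discrete Fourier transform of χ is a multiple of the Gauss sum, and the transform is
injective while χ(1) = 1. -/
theorem charGaussSum_ne_zero {N : ℕ} [NeZero N] {χ : DirichletCharacter ℂ N}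
    (hχ : χ.IsPrimitive) : charGaussSum χ ≠ 0 := by
  intro h0
  have h1 : ZMod.dft (χ : ZMod N → ℂ) = 0 := by
    ext k
    rw [hχ.fourierTransform_eq_inv_mul_gaussSum, ← charGaussSum, h0, mul_zero, Pi.zero_apply]
  have h2 := (LinearEquiv.map_eq_zero_iff _).mp h1
  have h3 := congrFun h2 1
  simp at h3

theorem stokesG_natAbs {N : ℕ} [NeZero N] (χ : DirichletCharacter ℂ N) (m : ℤ) :
    stokesG χ m = stokesG χ m.natAbs := by
  rw [stokesG, stokesG, Int.natAbs_natCast]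

theorem stokesG_of_even {N : ℕ} [NeZero N] {χ : DirichletCharacter ℂ N} (hχ : χ.Even) (m : ℤ) :
    stokesG χ m = 0 := by
  rw [stokesG, show χ (-1) = 1 from hχ]; simp

theorem stokesG_of_odd {N : ℕ} [NeZero N] {χ : DirichletCharacter ℂ N} (hχ : χ.Odd) (m : ℤ) :
    stokesG χ m = -2 * charGaussSum χ * charSigma χ⁻¹ m.natAbs := by
  rw [stokesG_eq, show χ (-1) = -1 from hχ]; ring

theorem summable_norm_stokesG_div_sq {N : ℕ} [NeZero N] (χ : DirichletCharacter ℂ N) :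
    Summable fun m : ℕ => ‖stokesG χ m‖ / (m : ℝ) ^ 2 := by
  have h1 := (LSeriesHasSum_charSigma χ⁻¹ (s := 2) (by simp)).LSeriesSummable.norm.mul_left
    ‖-(1 - χ (-1)) * charGaussSum χ‖
  refine h1.congr fun m => ?_
  rcases eq_or_ne m 0 with rfl | hm
  · simp
  · rw [LSeries.term_of_ne_zero hm, stokesG_eq, Int.natAbs_natCast, norm_mul _ (charSigma χ⁻¹ m),
      norm_div, ← Nat.cast_ofNat, cpow_natCast, norm_pow, Complex.norm_natCast]
    ring

/-- For even n both sides vanish, as B_{n+1} = 0. For odd n this is L(n+2, χ⁻¹) ζ(n+1) computed from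
Bernoulli values. The case n = 0 is excluded because B_1 ≠ 0. -/
theorem hasSum_stokesG_weightedGExpansion_coeff {N : ℕ} [NeZero N] {χ : DirichletCharacter ℂ N}
    (hχ : χ.IsPrimitive) (γ : ℂ) {n : ℕ} (hn : n ≠ 0) :
    HasSum (fun m : ℕ => stokesG χ m / (2 * Real.pi * I) *
        ((1 - (-1) ^ n) / (m : ℂ) ^ (n + 1)))
      ((weightedGExpansion χ γ).coeff n / (n.factorial : ℂ) *
        (2 * Real.pi * I / N) ^ (n + 1)) := by
  have hpi := two_pi_I_ne_zero
  have hNC : (N : ℂ) ≠ 0 := Nat.cast_ne_zero.mpr (NeZero.ne N)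
  rcases Nat.even_or_odd n with heven | hodd
  · have hb : bernoulli (n + 1) = 0 := bernoulli_eq_zero_of_odd heven.add_one (by omega)
    simp [heven.neg_one_pow, weightedGExpansion, hb]
  · have hre : 1 < (((n + 1 : ℕ) : ℂ)).re := by
      rw [natCast_re]; exact_mod_cast (by omega : 1 < n + 1)
    have h1 := (LSeriesHasSum_charSigma χ⁻¹ hre).mul_left
      (2 * (-(1 - χ (-1)) * charGaussSum χ) / (2 * Real.pi * I))
    have hval : 2 * (-(1 - χ (-1)) * charGaussSum χ) / (2 * Real.pi * I) *
        (DirichletCharacter.LFunction χ⁻¹ (((n + 1 : ℕ) : ℂ) + 1) * riemannZeta (n + 1 : ℕ)) =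
        (weightedGExpansion χ γ).coeff n / (n.factorial : ℂ) *
          (2 * Real.pi * I / N) ^ (n + 1) := by
      have h2 := gaussSum_mul_LFunction_eq_sum_bernoulliFun hχ (p := n + 2) (by omega)
        (by rw [Nat.odd_add]; simp [hodd])
      have h3 := two_mul_riemannZeta_eq_bernoulli (k := n + 1) (by omega) hodd.add_one
      have hcast : (((n + 1 : ℕ) : ℂ) + 1) = ((n + 2 : ℕ) : ℂ) := by push_cast; ring
      rw [hcast]
      have h4 : 2 * (-(1 - χ (-1)) * charGaussSum χ) / (2 * Real.pi * I) *
          (DirichletCharacter.LFunction χ⁻¹ ((n + 2 : ℕ) : ℂ) * riemannZeta (n + 1 : ℕ)) =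
          -((1 - χ (-1)) * charGaussSum χ * DirichletCharacter.LFunction χ⁻¹ ((n + 2 : ℕ) : ℂ)) *
            (2 * riemannZeta (n + 1 : ℕ)) / (2 * Real.pi * I) := by ring
      rw [h4, h2, h3]
      simp only [weightedGExpansion, weightMoment]
      rw [hodd.add_one.neg_pow, Nat.factorial_succ n, div_pow]
      push_cast
      have hfac : (n.factorial : ℂ) ≠ 0 := Nat.cast_ne_zero.mpr n.factorial_ne_zero
      have hfac2 : ((n + 2).factorial : ℂ) ≠ 0 := Nat.cast_ne_zero.mpr (Nat.factorial_ne_zero _)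
      have hn1 : (n : ℂ) + 1 ≠ 0 := by exact_mod_cast n.succ_ne_zero
      rw [show n + 1 + 1 = n + 2 from rfl]
      rw [neg_mul, neg_mul, neg_div]
      generalize (2 * Real.pi * I : ℂ) = τ at *
      field_simp
      ring
    rw [← hval]
    refine h1.congr_fun fun m => ?_
    rcases eq_or_ne m 0 with rfl | hm
    · simp [stokesG]
    · rw [LSeries.term_of_ne_zero hm, stokesG_eq, Int.natAbs_natCast, hodd.neg_one_pow,
        cpow_natCast]
      ring

theorem hasStokesTower_weightedGExpansion {N : ℕ} [NeZero N] {χ : DirichletCharacter ℂ N}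
    (hχ : χ.IsPrimitive) (γ : ℂ) :
    HasStokesTower (weightedGExpansion χ γ).coeff (2 * Real.pi * I / N) (stokesG χ) :=
  hasStokesTower_of_hasSum
    (div_ne_zero two_pi_I_ne_zero (Nat.cast_ne_zero.mpr (NeZero.ne N)))
    (by simp [stokesG]) (stokesG_natAbs χ) (summable_norm_stokesG_div_sq χ)
    fun _ hn => hasSum_stokesG_weightedGExpansion_coeff hχ γ hn

/-- Replacing y by y/N divides a_n by N^{n+1} and multiplies ω by N, so a_n ω^{n+1} is unchanged. -/
theorem hasStokesTower_weightedGExpansion_rescaled {N : ℕ} [NeZero N] {χ : DirichletCharacter ℂ N}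
    (hχ : χ.IsPrimitive) (γ : ℂ) :
    HasStokesTower (fun n => (weightedGExpansion χ γ).coeff n / (N : ℂ) ^ (n + 1))
      (2 * Real.pi * I) (stokesG χ) := by
  refine hasStokesTower_of_hasSum two_pi_I_ne_zero (by simp [stokesG]) (stokesG_natAbs χ)
    (summable_norm_stokesG_div_sq χ) fun n hn => ?_
  convert hasSum_stokesG_weightedGExpansion_coeff hχ γ hn using 1
  rw [div_pow]; ring

/-- All S_m vanish, so the series that represents a_n for n ≥ 1 is zero. -/
theorem weightedGExpansion_coeff_eq_zero_of_even {N : ℕ} [NeZero N] {χ : DirichletCharacter ℂ N}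
    (hχ : χ.IsPrimitive) (heven : χ.Even) (γ : ℂ) {n : ℕ} (hn : n ≠ 0) :
    (weightedGExpansion χ γ).coeff n = 0 := by
  have h1 := hasSum_stokesG_weightedGExpansion_coeff hχ γ hn
  simp only [stokesG_of_even heven, zero_div, zero_mul] at h1
  have h2 := h1.unique hasSum_zero
  have h3 : (2 * Real.pi * I / N : ℂ) ≠ 0 :=
    div_ne_zero two_pi_I_ne_zero (Nat.cast_ne_zero.mpr (NeZero.ne N))
  have h4 : (n.factorial : ℂ) ≠ 0 := Nat.cast_ne_zero.mpr n.factorial_ne_zero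
  simpa [h4, h3] using h2

theorem isModularResurgent_weightedGExpansion_of_odd {N : ℕ} [NeZero N] (hN : 2 ≤ N)
    {χ : DirichletCharacter ℂ N} (hχ : χ.IsPrimitive) (hodd : χ.Odd) (γ : ℂ) :
    IsModularResurgent (weightedGExpansion χ γ).coeff := by
  have htower := hasStokesTower_weightedGExpansion hχ γ
  have hG := charGaussSum_ne_zero hχ
  have hψ : χ⁻¹ ≠ 1 := inv_ne_one.mpr (hχ.ne_one hN)
  refine ⟨htower.choose_spec.1.isGevreyOne, 2 * Real.pi * I / N, stokesG χ,
    div_ne_zero two_pi_I_ne_zero (Nat.cast_ne_zero.mpr (NeZero.ne N)), htower,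
    fun m hm => ?_, ?_, ?_⟩
  · rw [stokesG_of_odd hodd]
    exact mul_ne_zero (mul_ne_zero (by norm_num) hG) (charSigma_ne_zero _ (Int.natAbs_ne_zero.mpr hm))
  · simp only [stokesG_of_odd hodd, Int.natAbs_natCast]
    exact isLFunctionCoeff_charSigma hψ (mul_ne_zero (by norm_num) hG)
  · simp only [stokesG_of_odd hodd, Int.natAbs_neg, Int.natAbs_natCast, ← neg_mul]
    exact isLFunctionCoeff_charSigma hψ (mul_ne_zero (by norm_num) hG)

theorem isModularResurgent_weightedGExpansion_iff {N : ℕ} [NeZero N] (hN : 2 ≤ N)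
    {χ : DirichletCharacter ℂ N} (hχ : χ.IsPrimitive) (γ : ℂ) :
    IsModularResurgent (weightedGExpansion χ γ).coeff ↔ χ.Odd := by
  refine ⟨fun h => ?_, fun h => isModularResurgent_weightedGExpansion_of_odd hN hχ h γ⟩
  refine χ.even_or_odd.resolve_left fun heven => ?_
  obtain ⟨-, A, S, hA, htower, hS, -⟩ := h
  exact not_hasStokesTower_of_eq_zero
    (fun n hn => weightedGExpansion_coeff_eq_zero_of_even hχ heven γ hn) hA (hS 1 one_ne_zero) htower

theorem theorem1p3 (N : ℕ) [NeZero N] (hN : 2 ≤ N) (χ : DirichletCharacter ℂ N)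
    (hχ : χ.IsPrimitive) :
    (∃! E : FormalExpansion, HasAsymptoticExpansion (weightedG χ) E) ∧
    ∀ E : FormalExpansion, HasAsymptoticExpansion (weightedG χ) E →
      (IsModularResurgent E.coeff ↔ χ.Odd) ∧
      -- the Stokes constants of the expansion of `𝔤(y)`, at the points `2 π i m / N`
      HasStokesTower E.coeff (2 * Real.pi * Complex.I / N) (stokesG χ) ∧
      -- the same for the expansion of `𝔤(y / N)`, at the points `2 π i m`
      HasStokesTower (fun n => E.coeff n / (N : ℂ) ^ (n + 1)) (2 * Real.pi * Complex.I)
        (stokesG χ) ∧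
      (χ.Odd → ∀ s : ℂ, 1 < s.re →
        LSeriesHasSum (fun m : ℕ => stokesG χ (m : ℤ)) s
          (-2 * charGaussSum χ * (DirichletCharacter.LFunction χ⁻¹ (s + 1) * riemannZeta s))) := by
  obtain ⟨γ, hγ⟩ := hasAsymptoticExpansion_weightedGExpansion (hχ.ne_one hN)
  refine ⟨⟨_, hγ, fun E hE => hE.unique hγ⟩, fun E hE => ?_⟩
  rw [hE.unique hγ]
  refine ⟨isModularResurgent_weightedGExpansion_iff hN hχ γ, hasStokesTower_weightedGExpansion hχ γ,
    hasStokesTower_weightedGExpansion_rescaled hχ γ, fun hodd s hs => ?_⟩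
  simp only [stokesG_of_odd hodd, Int.natAbs_natCast]
  exact (LSeriesHasSum_charSigma χ⁻¹ hs).smul (-2 * charGaussSum χ)
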